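/- **Setting.** Let $J\subset(0,\infty)$ be open and consider the body of all points with spherical coordinates $r\in J$, $\theta\in(0,\pi)$, $\phi\in\mathbb R$. All vectors and tensors are given by components in the frame $(\mathbf e_r,\mathbf e_\theta,\mathbf e_\phi)$ (indices $1,2,3$). The density $\rho=\rho(r)$, the frequency $\omega$ and the stiffnesses $c_{ijkl}=c_{ijkl}(r)$ may be complex, with $c_{ijkl}=c_{jikl}=c_{ijlk}=c_{klij}$. For a displacement $\mathbf u$ (time factor $e^{-i\omega t}$ omitted) let $\varepsilon=\tfrac12(\nabla\mathbf u+(\nabla\mathbf u)^T)$, $\sigma_{ij}=c_{ijkl}\varepsilon_{kl}$, let $\mathbf t_r,\mathbf t_\theta,\mathbf t_\phi$ be the rows of $\sigma$, and $$\boldsymbol\tau=\frac1{\sin\theta}\big[(\sin\theta\,\mathbf t_\theta)_{,\theta}+\mathbf t_{\phi,\phi}+\sin\theta\,\mathbf K\mathbf t_\theta+\mathbf H\mathbf t_\phi\big],\quad \mathbf K=\begin{pmatrix}0&-1&0\\1&0&0\\0&0&0\end{pmatrix},\quad \mathbf H=\begin{pmatrix}0&0&-\sin\theta\\0&0&-\cos\theta\\\sin\theta&\cos\theta&0\end{pmatrix},$$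 where commas denote differentiation of components. The equation of motion is $(r^2\mathbf t_r)_{,r}+r\boldsymbol\tau=-r^2\rho\,\omega^2\mathbf u$. The material is *transversely isotropic about $\mathbf e_r$* if for each $r\in J$ the components $c_{ijkl}(r)$ are invariant under all rotations about $\mathbf e_r$. For integers $n\ge0$, $|m|\le n$ put $\lambda=\sqrt{n(n+1)}$, $Y=Y_n^m(\theta,\phi)$ (the normalized spherical harmonic), $$\mathbf P=Y\mathbf e_r,\qquad \mathbf B=\lambda^{-1}\Big(\mathbf e_\theta\,\partial_\theta Y+\frac{\mathbf e_\phi}{\sin\theta}\,\partial_\phi Y\Big),\qquad \mathbf C=\mathbf B\times\mathbf e_r ,$$ with $\mathbf B=\mathbf C=\mathbf 0$ for $n=0$. Sums $\sum_{\mathbf A}$ run over $\mathbf A=\mathbf P,\mathbf B,\mathbf C$. A *separable solution* with amplitudes $\mathbf U=(U_{\mathbf P},U_{\mathbf B},U_{\mathbf C})^T$, $\mathbf T=(T_{\mathbf P},T_{\mathbf B},T_{\mathbf C})^T$ is a solution $\mathbf u=\sum_{\mathbf A}U_{\mathbf A}(r)\mathbf A$ of the equation of motion whose radial traction is $\mathbf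 t_r=\sum_{\mathbf A}T_{\mathbf A}(r)\mathbf A$. **Theorem.** (1) *Separation of variables requires transverse isotropy.* Suppose that for all $n,m$ and all differentiable amplitudes $\mathbf U(r)$ the displacement $\mathbf u=\sum_{\mathbf A}U_{\mathbf A}(r)\mathbf A$ yields $\mathbf t_r=\sum_{\mathbf A}T_{\mathbf A}(r)\mathbf A$ and $\boldsymbol\tau=\sum_{\mathbf A}\Gamma_{\mathbf A}(r)\mathbf A$ with coefficients that depend on $r$ only. Then the material is transversely isotropic about $\mathbf e_r$; and conversely every such material has this property. Likewise, if for the given $\rho,\omega$, for all $n,m$, all $r_0\in J$ and all initial data $\mathbf U(r_0),\mathbf U'(r_0)\in\mathbb C^3$ there is a separable solution near $r=r_0$ with these data, then the material is transversely isotropic about $\mathbf e_r$. (2) *The system.* Let the material be transversely isotropic about $\mathbf e_r$, with $c_{11}=c_{1111}$, $c_{12}=c_{1122}$, $c_{22}=c_{2222}$, $c_{44}=c_{2323}$, $c_{66}=c_{1212}$, and let $c_{11}(r)\ne0$, $c_{66}(r)\neq0$ on $J$. For all $n,m$ and all $\mathbf U,\mathbf T:J\to\mathbb C^3$ (with $U_{\mathbf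 B}=U_{\mathbf C}=T_{\mathbf B}=T_{\mathbf C}=0$ if $n=0$), $\mathbf U,\mathbf T$ are the amplitudes of a separable solution if and only if on $J$ $$\boldsymbol\eta'=\frac{i\mathbf G}{r^2}\boldsymbol\eta,\qquad \boldsymbol\eta=\begin{pmatrix}\mathbf U\\ ir^2\mathbf T\end{pmatrix},\qquad \mathbf G(r)=\begin{pmatrix} ir\mathcal T^{-1}\mathcal R^T&-\mathcal T^{-1}\\ r^2(\mathcal Q-\mathcal R\mathcal T^{-1}\mathcal R^T)-r^4\rho\,\omega^2\mathbf I&-ir\mathcal R\mathcal T^{-1}\end{pmatrix},$$ where $$\mathcal T=\mathrm{diag}[c_{11},c_{66},c_{66}],\qquad \mathcal R=\begin{pmatrix}2c_{12}&\lambda c_{66}&0\\-\lambda c_{12}&-c_{66}&0\\0&0&-c_{66}\end{pmatrix},$$ $$\mathcal Q=\begin{pmatrix}\lambda^2c_{66}+4(c_{22}-c_{44})&\lambda(2c_{44}-2c_{22}-c_{66})&0\\ \lambda(2c_{44}-2c_{22}-c_{66})&\lambda^2c_{22}+c_{66}-2c_{44}&0\\0&0&\lambda^2c_{44}+c_{66}-2c_{44}\end{pmatrix}.$$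 (3) *Symmetry.* If in (2) the material parameters $c_{ijkl}$, $\rho$ and $\omega^2$ are real, then $\mathbf G=\mathbb T\mathbf G^+\mathbb T$, where $^+$ is Hermitian conjugation and $\mathbb T=\begin{pmatrix}0&\mathbf I\\\mathbf I&0\end{pmatrix}$. -/

import Mathlib

open scoped Matrix

noncomputable section

namespace SphericalStroh

/-! ### Scalar and vector spherical harmonics -/

/-- Associated Legendre function of the first kind (no Condon-Shortley phase),
`P_n^m(x) = (1 - x²)^{m/2} / (2ⁿ n!) · d^{n+m}/dx^{n+m} (x² - 1)ⁿ`, for `-n ≤ m ≤ n`, `-1 < x < 1`. -/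
def assocLegendre (n : ℕ) (m : ℤ) (x : ℝ) : ℝ :=
  Real.sqrt (1 - x ^ 2) ^ m / (2 ^ n * (n.factorial : ℝ)) *
    ((Polynomial.derivative^[((n : ℤ) + m).toNat]
      ((Polynomial.X ^ 2 - 1 : Polynomial ℝ) ^ n)).eval x)

/-- Normalization `A_n^m = (-1)^m √((2n+1)/(4π) · (n-m)!/(n+m)!)`. -/
def harmonicNorm (n : ℕ) (m : ℤ) : ℝ :=
  (-1) ^ m * Real.sqrt ((2 * (n : ℝ) + 1) / (4 * Real.pi) *
    ((((n : ℤ) - m).toNat.factorial : ℝ) / (((n : ℤ) + m).toNat.factorial : ℝ)))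

/-- Spherical harmonic `Y_n^m = A_n^m P_n^m(cos θ) e^{imφ}`. -/
def sphHarmonic (n : ℕ) (m : ℤ) (θ φ : ℝ) : ℂ :=
  ((harmonicNorm n m * assocLegendre n m (Real.cos θ) : ℝ) : ℂ) *
    Complex.exp (Complex.I * (m : ℂ) * (φ : ℂ))

/-- `λ = √(n(n+1))`. -/
def lam (n : ℕ) : ℝ := Real.sqrt ((n : ℝ) * ((n : ℝ) + 1))

/-- `P_{mn} = e_r Y_n^m`; all vectors are given by their components in the frame
`(e_r, e_θ, e_φ)`, indexed by `0, 1, 2`. -/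
def harmP (n : ℕ) (m : ℤ) (θ φ : ℝ) : Fin 3 → ℂ :=
  ![sphHarmonic n m θ φ, 0, 0]

/-- `B_{mn} = λ⁻¹ (e_θ ∂_θ + e_φ (sin θ)⁻¹ ∂_φ) Y_n^m` (the zero vector for `n = 0`). -/
def harmB (n : ℕ) (m : ℤ) (θ φ : ℝ) : Fin 3 → ℂ :=
  ((lam n)⁻¹ : ℂ) •
    ![0, deriv (fun t : ℝ => sphHarmonic n m t φ) θ,
      ((Real.sin θ)⁻¹ : ℂ) * deriv (fun p : ℝ => sphHarmonic n m θ p) φ]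

/-- `C_{mn} = B_{mn} × e_r`. -/
def harmC (n : ℕ) (m : ℤ) (θ φ : ℝ) : Fin 3 → ℂ :=
  crossProduct (harmB n m θ φ) ![1, 0, 0]

/-- A vector field in spherical coordinates `(r, θ, φ)`, through its components in
`(e_r, e_θ, e_φ)`. -/
abbrev Field := ℝ → ℝ → ℝ → Fin 3 → ℂ

/-- `∑_A V_A(r) A` over `A = P, B, C`, where `V = (V_P, V_B, V_C)`. -/
def expand (n : ℕ) (m : ℤ) (V : ℝ → Fin 3 → ℂ) : Field := fun r θ φ =>
  V r 0 • harmP n m θ φ + V r 1 • harmB n m θ φ + V r 2 • harmC n m θ φ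

/-! ### Linear elasticity in spherical coordinates -/

/-- A fourth-order tensor, through its components in the frame `(e_r, e_θ, e_φ)`. -/
abbrev Tensor4 := Fin 3 → Fin 3 → Fin 3 → Fin 3 → ℂ

/-- The index symmetries of an elastic tensor. -/
structure IsElastic (C : Tensor4) : Prop where
  minor_left : ∀ i j k l, C i j k l = C j i k l
  minor_right : ∀ i j k l, C i j k l = C i j l k
  major : ∀ i j k l, C i j k l = C k l i j

/-- Rotation through the angle `α` about the first (radial) axis. -/
def rotR (α : ℝ) : Matrix (Fin 3) (Fin 3) ℝ :=
  !![1, 0, 0;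
     0, Real.cos α, -Real.sin α;
     0, Real.sin α, Real.cos α]

/-- Transverse isotropy about `e_r`: invariance of the components under all rotations
about `e_r`. -/
def IsTI (C : Tensor4) : Prop :=
  ∀ (α : ℝ) (i j k l : Fin 3),
    ∑ a, ∑ b, ∑ c, ∑ d,
      ((rotR α i a * rotR α j b * rotR α k c * rotR α l d : ℝ) : ℂ) * C a b c d = C i j k l

/-- The matrix `K`, so that `∂_θ (∑ aᵢ eᵢ) = ∑ (a_{,θ} + K a)ᵢ eᵢ`. -/
def matK : Matrix (Fin 3) (Fin 3) ℂ :=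
  !![0, -1, 0;
     1, 0, 0;
     0, 0, 0]

/-- The matrix `H`, so that `∂_φ (∑ aᵢ eᵢ) = ∑ (a_{,φ} + H a)ᵢ eᵢ`. -/
def matH (θ : ℝ) : Matrix (Fin 3) (Fin 3) ℂ :=
  !![0, 0, -(Real.sin θ : ℂ);
     0, 0, -(Real.cos θ : ℂ);
     (Real.sin θ : ℂ), (Real.cos θ : ℂ), 0]

/-- The displacement gradient: row `i` holds the components of the derivative of `u` in the
direction of the `i`-th frame vector. -/
def grad (u : Field) (r θ φ : ℝ) : Fin 3 → Fin 3 → ℂ :=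
  ![fun j => deriv (fun s : ℝ => u s θ φ j) r,
    fun j => ((r : ℂ))⁻¹ *
      (deriv (fun t : ℝ => u r t φ j) θ + (matK *ᵥ u r θ φ) j),
    fun j => ((r * Real.sin θ : ℝ) : ℂ)⁻¹ *
      (deriv (fun p : ℝ => u r θ p j) φ + (matH θ *ᵥ u r θ φ) j)]

/-- The strain `ε = (∇u + (∇u)ᵀ)/2`. -/
def strain (u : Field) (r θ φ : ℝ) (k l : Fin 3) : ℂ :=
  (grad u r θ φ k l + grad u r θ φ l k) / 2

/-- The traction `t_i`, with components `(t_i)_j = σ_{ij} = c_{ijkl} ε_{kl}`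
(`i = 0, 1, 2` for `r, θ, φ`), for a stiffness depending on `r` only. -/
def traction (c : ℝ → Tensor4) (u : Field) (i : Fin 3) : Field := fun r θ φ j =>
  ∑ k, ∑ l, c r i j k l * strain u r θ φ k l

/-- `τ = (sin θ)⁻¹ [(sin θ t_θ)_{,θ} + t_{φ,φ} + sin θ K t_θ + H t_φ]`. -/
def tau (c : ℝ → Tensor4) (u : Field) : Field := fun r θ φ j =>
  ((Real.sin θ : ℂ))⁻¹ *
    (deriv (fun t : ℝ => (Real.sin t : ℂ) * traction c u 1 r t φ j) θ
      + deriv (fun p : ℝ => traction c u 2 r θ p j) φ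
      + (Real.sin θ : ℂ) * (matK *ᵥ traction c u 1 r θ φ) j
      + (matH θ *ᵥ traction c u 2 r θ φ) j)

/-- `u` is (the amplitude of) a time-harmonic solution of frequency `ω` in the body of all
points with `r ∈ J`: the derivatives that occur exist, and
`(r² t_r)_{,r} + r τ = -r² ρ ω² u`. -/
def IsTimeHarmonicSolution (J : Set ℝ) (c : ℝ → Tensor4) (ρ : ℝ → ℂ) (ω : ℂ)
    (u : Field) : Prop :=
  ∀ r ∈ J, ∀ θ ∈ Set.Ioo 0 Real.pi, ∀ φ : ℝ, ∀ j : Fin 3,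
    DifferentiableAt ℝ (fun s : ℝ => u s θ φ j) r ∧
    DifferentiableAt ℝ (fun t : ℝ => u r t φ j) θ ∧
    DifferentiableAt ℝ (fun p : ℝ => u r θ p j) φ ∧
    DifferentiableAt ℝ (fun t : ℝ => (Real.sin t : ℂ) * traction c u 1 r t φ j) θ ∧
    DifferentiableAt ℝ (fun p : ℝ => traction c u 2 r θ p j) φ ∧
    HasDerivAt (fun s : ℝ => (s : ℂ) ^ 2 * traction c u 0 s θ φ j)
      (-(r : ℂ) ^ 2 * ρ r * ω ^ 2 * u r θ φ j - (r : ℂ) * tau c u r θ φ j) r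

/-! ### Separation of variables -/

/-- `F = ∑_A V_A(r) A` at all points with `r ∈ J`. -/
def HasAmplitudes (J : Set ℝ) (n : ℕ) (m : ℤ) (F : Field) (V : ℝ → Fin 3 → ℂ) : Prop :=
  ∀ r ∈ J, ∀ θ ∈ Set.Ioo 0 Real.pi, ∀ φ : ℝ, F r θ φ = expand n m V r θ φ

/-- The equations of motion separate in vector spherical harmonics: for all orders `n, m` and
all amplitudes `U(r)`, the displacement `u = ∑_A U_A(r) A` yields `t_r` and `τ` that are again of
the forms `∑_A T_A(r) A` and `∑_A Γ_A(r) A`. -/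
def EquationsSeparate (J : Set ℝ) (c : ℝ → Tensor4) : Prop :=
  ∀ (n : ℕ) (m : ℤ), m.natAbs ≤ n →
    ∀ U : ℝ → Fin 3 → ℂ, DifferentiableOn ℝ U J →
      ∃ T Γ : ℝ → Fin 3 → ℂ,
        HasAmplitudes J n m (traction c (expand n m U) 0) T ∧
        HasAmplitudes J n m (tau c (expand n m U)) Γ

/-- `U`, `T` are the amplitudes of a separable time-harmonic solution: `u = ∑_A U_A(r) A` solves
the equations of motion and its radial traction is `t_r = ∑_A T_A(r) A`. -/
def IsSeparableSolution (J : Set ℝ) (c : ℝ → Tensor4) (ρ : ℝ → ℂ) (ω : ℂ)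
    (n : ℕ) (m : ℤ) (U T : ℝ → Fin 3 → ℂ) : Prop :=
  IsTimeHarmonicSolution J c ρ ω (expand n m U) ∧
  HasAmplitudes J n m (traction c (expand n m U) 0) T

/-- For all orders `n, m`, every radius `r₀` of the body and all initial data for the amplitudes
and their first derivatives there is a separable solution near `r = r₀` with these data. -/
def AdmitsSeparableSolutions (J : Set ℝ) (c : ℝ → Tensor4) (ρ : ℝ → ℂ) (ω : ℂ) : Prop :=
  ∀ (n : ℕ) (m : ℤ), m.natAbs ≤ n →
    ∀ r₀ ∈ J, ∀ U₀ V₀ : Fin 3 → ℂ,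
      ∃ N : Set ℝ, IsOpen N ∧ r₀ ∈ N ∧ N ⊆ J ∧
        ∃ U T : ℝ → Fin 3 → ℂ, U r₀ = U₀ ∧ HasDerivAt U V₀ r₀ ∧
          IsSeparableSolution N c ρ ω n m U T

/-! ### The system matrix -/

/-- `c₁₁ = c_{rrrr}`. -/
def c11 (C : Tensor4) : ℂ := C 0 0 0 0
/-- `c₁₂ = c_{rrθθ}`. -/
def c12 (C : Tensor4) : ℂ := C 0 0 1 1
/-- `c₂₂ = c_{θθθθ}`. -/
def c22 (C : Tensor4) : ℂ := C 1 1 1 1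
/-- `c₄₄ = c_{θφθφ}`. -/
def c44 (C : Tensor4) : ℂ := C 1 2 1 2
/-- `c₆₆ = c_{rθrθ}`. -/
def c66 (C : Tensor4) : ℂ := C 0 1 0 1

/-- `𝒯 = diag[c₁₁, c₆₆, c₆₆]`. -/
def matT (C : Tensor4) : Matrix (Fin 3) (Fin 3) ℂ :=
  Matrix.diagonal ![c11 C, c66 C, c66 C]

/-- The matrix `ℛ`. -/
def matR (C : Tensor4) (n : ℕ) : Matrix (Fin 3) (Fin 3) ℂ :=
  !![2 * c12 C, (lam n : ℂ) * c66 C, 0;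
     -(lam n : ℂ) * c12 C, -c66 C, 0;
     0, 0, -c66 C]

/-- The matrix `𝒬`. -/
def matQ (C : Tensor4) (n : ℕ) : Matrix (Fin 3) (Fin 3) ℂ :=
  !![(lam n : ℂ) ^ 2 * c66 C + 4 * (c22 C - c44 C),
       (lam n : ℂ) * (2 * c44 C - 2 * c22 C - c66 C), 0;
     (lam n : ℂ) * (2 * c44 C - 2 * c22 C - c66 C),
       (lam n : ℂ) ^ 2 * c22 C + c66 C - 2 * c44 C, 0;
     0, 0, (lam n : ℂ) ^ 2 * c44 C + c66 C - 2 * c44 C]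

/-- The system matrix `G(r)`. -/
def matG (c : ℝ → Tensor4) (ρ : ℝ → ℂ) (ω : ℂ) (n : ℕ) (r : ℝ) :
    Matrix (Fin 3 ⊕ Fin 3) (Fin 3 ⊕ Fin 3) ℂ :=
  Matrix.fromBlocks
    ((Complex.I * (r : ℂ)) • ((matT (c r))⁻¹ * (matR (c r) n)ᵀ))
    (-(matT (c r))⁻¹)
    ((r : ℂ) ^ 2 • (matQ (c r) n - matR (c r) n * (matT (c r))⁻¹ * (matR (c r) n)ᵀ)
      - ((r : ℂ) ^ 4 * ρ r * ω ^ 2) • (1 : Matrix (Fin 3) (Fin 3) ℂ))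
    (-(Complex.I * (r : ℂ)) • (matR (c r) n * (matT (c r))⁻¹))

/-- `𝕋`: zero diagonal blocks and identity off-diagonal blocks. -/
def swapT : Matrix (Fin 3 ⊕ Fin 3) (Fin 3 ⊕ Fin 3) ℂ :=
  Matrix.fromBlocks 0 1 1 0

/-- The state vector `η = (U, i r² T)`. -/
def stateVec (U T : ℝ → Fin 3 → ℂ) (r : ℝ) : Fin 3 ⊕ Fin 3 → ℂ :=
  Sum.elim (U r) ((Complex.I * (r : ℂ) ^ 2) • T r)

/-- The system `η' = (i G / r²) η` on `J`. -/
def SolvesStroh (J : Set ℝ) (c : ℝ → Tensor4) (ρ : ℝ → ℂ) (ω : ℂ) (n : ℕ)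
    (U T : ℝ → Fin 3 → ℂ) : Prop :=
  ∀ r ∈ J, HasDerivAt (stateVec U T)
    ((Complex.I / (r : ℂ) ^ 2) • (matG c ρ ω n r *ᵥ stateVec U T r)) r

end SphericalStroh

end

/-!
The vector spherical harmonics separate into an azimuthal and a latitudinal factor,
`P = e^{imφ} (f, 0, 0)`, `B = e^{imφ} (0, g, i h)`, `C = e^{imφ} (0, i h, -g)`, and Legendre's
equation becomes a linear first-order system for `f, g, h` with the constraint
`m f = λ sin θ h` (`IsProfile`). Everything about the harmonics that the theorem needs follows from
this system: the strain of a displacement `∑ U_A A` at a radius is `e^{imφ}` times a matrix that is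
linear in `f, g, h, g', h'` with coefficients free of `θ` (`strain_expand`), so that tractions and
`τ` can be computed for any stiffness (`traction_expand`, `tau_expand`).

*Sufficiency and the system.* An elastic tensor is transversely isotropic exactly if it satisfies
sixteen linear relations (`TIRelations`), which make it a combination of products of `e_r ⊗ e_r` and
the tangential projector. For such a tensor the computation gives
`t_r = ∑ T_A A` with `T = 𝒯 U' + r⁻¹ ℛᵀ U` and `τ = ∑ Γ_A A` with `Γ = -r⁻¹ 𝒬 U - ℛ U'`
(`TIRelations.traction_and_tau`). Solving the first relation for `U'` and inserting the second one in
the equation of motion `(r² T)' + r Γ = -r² ρ ω² U` is the first-order system (`stroh_rhs`).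
To pass from fields to amplitudes one needs that amplitudes can be recovered from finitely many
values of the field (`exists_amplitude_functionals`); this also makes them differentiable.

*Necessity.* Separation is a condition at each radius, with `U` and `U'` there arbitrary
(`SeparatesAt`). For the local solutions it follows because the derivative of `r² t_r` is again a
combination of the harmonics, and then so is `τ` by the equation of motion. The harmonics
`(n, m) = (0, 0)` and `(2, 2)` suffice: comparing coefficients of the explicit trigonometric
polynomials yields all sixteen relations (`TIRelations.of_separatesAt`).
-/

noncomputable section

namespace SphericalStroh

/-! ### Derivatives of powers of `x² - 1` -/

open Polynomial in
/-- The differential equation of the `k`-th derivative of `(x² - 1)ⁿ`; at `k = n + m` it is the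
associated Legendre equation after removal of the factor `(1 - x²)^{m/2}`. -/
lemma iterate_derivative_sq_sub_one_pow_ode (n k : ℕ) :
    (X ^ 2 - 1 : ℝ[X]) * derivative^[k + 2] ((X ^ 2 - 1) ^ n)
      + C (2 * ((k : ℝ) + 1 - n)) * X * derivative^[k + 1] ((X ^ 2 - 1) ^ n)
      + C (((k : ℝ) + 1) * (k - 2 * n)) * derivative^[k] ((X ^ 2 - 1) ^ n) = 0 := by
  induction k with
  | zero =>
    have h1 : (X ^ 2 - 1 : ℝ[X]) * derivative ((X ^ 2 - 1) ^ n)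
        = C (2 * (n : ℝ)) * X * (X ^ 2 - 1) ^ n := by
      cases n with
      | zero => simp
      | succ n =>
        simp [derivative_pow]
        ring
    have h2 := congrArg derivative h1
    simp only [derivative_mul, derivative_sub, derivative_X_pow, derivative_one,
      derivative_C, derivative_X] at h2
    simp only [zero_add, Function.iterate_succ, Function.comp, Function.iterate_zero, id]
    simp only [map_mul, map_add, map_sub, map_natCast, map_one, map_ofNat] at h2 ⊢
    push_cast at h2 ⊢
    linear_combination h2
  | succ k ih =>
    have h2 := congrArg derivative ih
    simp only [derivative_mul, derivative_sub, derivative_X_pow, derivative_one, derivative_add,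
      derivative_C, derivative_X, ← Function.iterate_succ_apply', derivative_zero] at h2
    simp only [map_mul, map_add, map_sub, map_natCast, map_one, map_ofNat] at h2 ⊢
    push_cast at h2 ⊢
    linear_combination h2

open Polynomial in
lemma iterate_derivative_sq_sub_one_pow_ne_zero {n k : ℕ} (hk : k ≤ 2 * n) :
    derivative^[k] ((X ^ 2 - 1 : ℝ[X]) ^ n) ≠ 0 := by
  intro h
  have h1 := congrArg (fun p => p.coeff (2 * n - k)) h
  have hm : (X ^ 2 - 1 : ℝ[X]).Monic := by
    simpa using monic_X_pow_sub_C (1 : ℝ) two_ne_zero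
  have hd : (X ^ 2 - 1 : ℝ[X]).natDegree = 2 := by
    simpa using natDegree_X_pow_sub_C (n := 2) (r := (1 : ℝ))
  have hc : ((X ^ 2 - 1 : ℝ[X]) ^ n).coeff (2 * n) = 1 := by
    have := (hm.pow n).coeff_natDegree
    rwa [hm.natDegree_pow, hd, mul_comm] at this
  simp only [coeff_iterate_derivative, Nat.sub_add_cancel hk, hc, coeff_zero] at h1
  simp [Nat.descFactorial_eq_zero_iff_lt] at h1
  omega

/-! ### Separation of the angles in a vector spherical harmonic -/

/-- The system satisfied by the latitudinal profiles of a vector spherical harmonic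
`P = e^{imφ} (f, 0, 0)`, `B = e^{imφ} (0, g, i h)`, `C = e^{imφ} (0, i h, -g)`, with `l = λ`.
It encodes Legendre's equation as a first-order system with an algebraic constraint, in a form
that stays valid for `n = 0`, where `l`, `m`, `g` and `h` vanish. -/
structure IsProfile (l m : ℂ) (f g h : ℝ → ℂ) : Prop where
  deriv_f : ∀ θ ∈ Set.Ioo 0 Real.pi, HasDerivAt f (l * g θ) θ
  deriv_g : ∀ θ ∈ Set.Ioo 0 Real.pi,
    HasDerivAt g (-(Real.cos θ / Real.sin θ) * g θ - l * f θ + m / Real.sin θ * h θ) θ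
  deriv_h : ∀ θ ∈ Set.Ioo 0 Real.pi,
    HasDerivAt h (m / Real.sin θ * g θ - Real.cos θ / Real.sin θ * h θ) θ
  constraint : ∀ θ ∈ Set.Ioo 0 Real.pi, m * f θ = l * Real.sin θ * h θ

/-- The azimuthal factor `e^{imφ}`. -/
def azim (m : ℤ) (φ : ℝ) : ℂ := Complex.exp (Complex.I * (m : ℂ) * (φ : ℂ))

lemma azim_ne_zero (m : ℤ) (φ : ℝ) : azim m φ ≠ 0 := Complex.exp_ne_zero _

lemma azim_zero_right (m : ℤ) : azim m 0 = 1 := by simp [azim]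

lemma hasDerivAt_azim (m : ℤ) (φ : ℝ) :
    HasDerivAt (azim m) (Complex.I * m * azim m φ) φ := by
  have h := ((Complex.ofRealCLM.hasDerivAt (x := φ)).const_mul (Complex.I * (m : ℂ))).cexp
  simp only [Complex.ofRealCLM_apply, Complex.ofReal_one, mul_one] at h
  exact h.congr_deriv (mul_comm _ _)

/-- The latitudinal profile of `Y`, hence of `P`. -/
def latP (n : ℕ) (m : ℤ) (θ : ℝ) : ℂ :=
  ((harmonicNorm n m * assocLegendre n m (Real.cos θ) : ℝ) : ℂ)

/-- The latitudinal profile `λ⁻¹ Y_{,θ}` of the `θ`-component of `B`. -/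
def latB (n : ℕ) (m : ℤ) (θ : ℝ) : ℂ := ((lam n : ℂ))⁻¹ * deriv (latP n m) θ

/-- The latitudinal profile `m Y / (λ sin θ)` of `-i` times the `φ`-component of `B`. -/
def latC (n : ℕ) (m : ℤ) (θ : ℝ) : ℂ :=
  ((lam n : ℂ))⁻¹ * ((m : ℂ) / (Real.sin θ : ℂ) * latP n m θ)

lemma sin_pos_of_mem {θ : ℝ} (hθ : θ ∈ Set.Ioo 0 Real.pi) : 0 < Real.sin θ :=
  Real.sin_pos_of_mem_Ioo hθ

lemma sphHarmonic_eq (n : ℕ) (m : ℤ) (θ φ : ℝ) :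
    sphHarmonic n m θ φ = azim m φ * latP n m θ := by
  rw [sphHarmonic, latP, azim, mul_comm]

lemma harmP_eq (n : ℕ) (m : ℤ) (θ φ : ℝ) :
    harmP n m θ φ = azim m φ • ![latP n m θ, 0, 0] := by
  simp [harmP, sphHarmonic_eq]

lemma harmB_eq (n : ℕ) (m : ℤ) (θ φ : ℝ) :
    harmB n m θ φ = azim m φ • ![0, latB n m θ, Complex.I * latC n m θ] := by
  have h1 : deriv (fun t : ℝ => sphHarmonic n m t φ) θ = azim m φ * deriv (latP n m) θ := by
    simp only [sphHarmonic_eq]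
    exact deriv_const_mul_field _
  have h2 : deriv (fun p : ℝ => sphHarmonic n m θ p) φ
      = Complex.I * m * azim m φ * latP n m θ := by
    simp only [sphHarmonic_eq]
    exact ((hasDerivAt_azim m φ).mul_const _).deriv
  rw [harmB, h1, h2]
  ext j
  fin_cases j <;> simp [latB, latC] <;> ring

lemma harmC_eq (n : ℕ) (m : ℤ) (θ φ : ℝ) :
    harmC n m θ φ = azim m φ • ![0, Complex.I * latC n m θ, -latB n m θ] := by
  rw [harmC, harmB_eq]
  ext j
  fin_cases j <;> simp [crossProduct]

/-- On `(0, π)` the profile of `Y` is `K sin^m θ q(cos θ)`, with `q` the derivative of order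
`n + m` of `(x² - 1)ⁿ`. -/
lemma latP_eq (n : ℕ) (m : ℤ) {θ : ℝ} (hθ : θ ∈ Set.Ioo 0 Real.pi) :
    latP n m θ = ((harmonicNorm n m / (2 ^ n * (n.factorial : ℝ)) * (Real.sin θ ^ m *
      (Polynomial.derivative^[((n : ℤ) + m).toNat]
      ((Polynomial.X ^ 2 - 1 : Polynomial ℝ) ^ n)).eval (Real.cos θ)) : ℝ) : ℂ) := by
  have h : Real.sqrt (1 - Real.cos θ ^ 2) = Real.sin θ := by
    rw [← Real.sin_sq, Real.sqrt_sq (sin_pos_of_mem hθ).le]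
  rw [latP, assocLegendre, h]
  congr 1
  ring

lemma harmonicNorm_ne_zero (n : ℕ) (m : ℤ) : harmonicNorm n m ≠ 0 := by
  unfold harmonicNorm
  refine mul_ne_zero (zpow_ne_zero _ (by norm_num)) (Real.sqrt_ne_zero'.2 ?_)
  have := Real.pi_pos
  have h1 := Nat.factorial_pos ((n : ℤ) - m).toNat
  have h2 := Nat.factorial_pos ((n : ℤ) + m).toNat
  positivity

lemma exists_latP_ne_zero {n : ℕ} {m : ℤ} (hm : m.natAbs ≤ n) :
    ∃ θ ∈ Set.Ioo 0 Real.pi, latP n m θ ≠ 0 := by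
  have hq : Polynomial.derivative^[((n : ℤ) + m).toNat]
      ((Polynomial.X ^ 2 - 1 : Polynomial ℝ) ^ n) ≠ 0 :=
    iterate_derivative_sq_sub_one_pow_ne_zero (by omega)
  obtain ⟨x, hx, hx'⟩ := (Set.Ioo_infinite (show (-1 : ℝ) < 1 by norm_num)).exists_notMem_finset
    (Polynomial.derivative^[((n : ℤ) + m).toNat]
      ((Polynomial.X ^ 2 - 1 : Polynomial ℝ) ^ n)).roots.toFinset
  have hθ : Real.arccos x ∈ Set.Ioo 0 Real.pi :=
    ⟨Real.arccos_pos.2 hx.2, Real.arccos_lt_pi.2 hx.1⟩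
  refine ⟨_, hθ, ?_⟩
  rw [latP_eq n m hθ, Real.cos_arccos hx.1.le hx.2.le]
  rw [Multiset.mem_toFinset, Polynomial.mem_roots hq, Polynomial.IsRoot] at hx'
  have h1 := (sin_pos_of_mem hθ).ne'
  have h2 := harmonicNorm_ne_zero n m
  have h3 : (n.factorial : ℝ) ≠ 0 := by exact_mod_cast n.factorial_ne_zero
  exact_mod_cast mul_ne_zero (div_ne_zero h2 (by positivity)) (mul_ne_zero (zpow_ne_zero _ h1) hx')

/-- Legendre's equation for the profile of `Y`. -/
lemma exists_latP_derivs {n : ℕ} {m : ℤ} (hm : m.natAbs ≤ n) :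
    ∃ F : ℝ → ℂ, (∀ θ ∈ Set.Ioo 0 Real.pi, HasDerivAt (latP n m) (F θ) θ ∧
      HasDerivAt F (-(Real.cos θ / Real.sin θ) * F θ
        - ((n : ℂ) * (n + 1) - (m : ℂ) ^ 2 / (Real.sin θ : ℂ) ^ 2) * latP n m θ) θ) ∧
      (n = 0 → ∀ θ, F θ = 0) := by
  set k := ((n : ℤ) + m).toNat with hk
  have hkm : (k : ℝ) = n + m := by
    have : (k : ℤ) = n + m := by omega
    exact_mod_cast this
  set q := Polynomial.derivative^[k] ((Polynomial.X ^ 2 - 1 : Polynomial ℝ) ^ n) with hq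
  set K := harmonicNorm n m / (2 ^ n * (n.factorial : ℝ)) with hK
  have hode : ∀ x : ℝ, (x ^ 2 - 1) * q.derivative.derivative.eval x
      + 2 * (m + 1) * x * q.derivative.eval x
      + (m * (m + 1) - n * (n + 1)) * q.eval x = 0 := by
    intro x
    have h := congrArg (Polynomial.eval x) (iterate_derivative_sq_sub_one_pow_ode n k)
    rw [Function.iterate_succ_apply', Function.iterate_succ_apply', ← hq, hkm] at h
    simp only [Polynomial.eval_add, Polynomial.eval_mul, Polynomial.eval_sub, Polynomial.eval_pow,
      Polynomial.eval_X, Polynomial.eval_one, Polynomial.eval_C, Polynomial.eval_zero] at h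
    linear_combination h
  have hz : ∀ θ ∈ Set.Ioo 0 Real.pi,
      HasDerivAt (fun t => Real.sin t ^ m) (Real.sin θ ^ m * (m * Real.cos θ / Real.sin θ)) θ := by
    intro θ hθ
    have hs := (sin_pos_of_mem hθ).ne'
    have h := (hasDerivAt_zpow m (Real.sin θ) (Or.inl hs)).comp θ (Real.hasDerivAt_sin θ)
    refine h.congr_deriv ?_
    rw [zpow_sub_one₀ hs]
    field_simp
  have hpoly : ∀ (p : Polynomial ℝ) (θ : ℝ), HasDerivAt (fun t => p.eval (Real.cos t))
      (p.derivative.eval (Real.cos θ) * -Real.sin θ) θ := fun p θ =>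
    (p.hasDerivAt (Real.cos θ)).comp θ (Real.hasDerivAt_cos θ)
  refine ⟨fun θ => ((K * (Real.sin θ ^ m * (m * Real.cos θ / Real.sin θ * q.eval (Real.cos θ)
    - Real.sin θ * q.derivative.eval (Real.cos θ))) : ℝ) : ℂ), fun θ hθ => ⟨?_, ?_⟩, ?_⟩
  · have h := (((hz θ hθ).mul (hpoly q θ)).const_mul K).ofReal_comp
    refine (h.congr_of_eventuallyEq ?_).congr_deriv ?_
    · filter_upwards [isOpen_Ioo.mem_nhds hθ] with t ht
      rw [latP_eq n m ht]
      rfl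
    · congr 1
      ring
  · have hs := (sin_pos_of_mem hθ).ne'
    have h1 := (((Real.hasDerivAt_cos θ).const_mul (m : ℝ)).div (Real.hasDerivAt_sin θ) hs).mul
      (hpoly q θ)
    have h2 := (Real.hasDerivAt_sin θ).mul (hpoly q.derivative θ)
    have h := (((hz θ hθ).mul (h1.sub h2)).const_mul K).ofReal_comp
    refine h.congr_deriv ?_
    have key := hode (Real.cos θ)
    have hcs := Real.sin_sq_add_cos_sq θ
    rw [latP_eq n m hθ, ← hk, ← hq, ← hK]
    simp only [Pi.mul_apply, Pi.sub_apply, Pi.div_apply]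
    generalize Real.sin θ ^ m = z
    generalize Polynomial.eval (Real.cos θ) q = q0 at *
    generalize Polynomial.eval (Real.cos θ) (Polynomial.derivative q) = q1 at *
    generalize Polynomial.eval (Real.cos θ) (Polynomial.derivative (Polynomial.derivative q)) = q2
      at *
    generalize Real.sin θ = s at *
    generalize Real.cos θ = c at *
    have hq2 : q2 = (2 * (m + 1) * c * q1 + (m * (m + 1) - n * (n + 1)) * q0) / s ^ 2 := by
      field_simp
      linear_combination q2 * hcs - key
    have hsC : (s : ℂ) ≠ 0 := by exact_mod_cast hs
    have hcsC : (s : ℂ) ^ 2 + (c : ℂ) ^ 2 = 1 := by exact_mod_cast hcs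
    rw [hq2]
    push_cast
    field_simp
    linear_combination (K * z * m ^ 2 * q0 : ℂ) * hcsC
  · intro h0 θ
    have hm0 : m = 0 := by omega
    subst h0
    subst hm0
    have : q = 1 := by simp [hq, hk]
    simp [this]

lemma lam_sq (n : ℕ) : (lam n : ℂ) ^ 2 = (n : ℂ) * (n + 1) := by
  have : lam n ^ 2 = (n : ℝ) * (n + 1) := Real.sq_sqrt (by positivity)
  exact_mod_cast this

lemma lam_ne_zero {n : ℕ} (hn : n ≠ 0) : (lam n : ℂ) ≠ 0 := by
  have h : 0 < (n : ℝ) := by positivity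
  have h1 : lam n ≠ 0 := (Real.sqrt_pos.2 (by positivity : 0 < (n : ℝ) * ((n : ℝ) + 1))).ne'
  exact_mod_cast h1

lemma lam_zero : lam 0 = 0 := by simp [lam]

lemma isProfile_lat {n : ℕ} {m : ℤ} (hm : m.natAbs ≤ n) :
    IsProfile (lam n) m (latP n m) (latB n m) (latC n m) := by
  obtain ⟨F, hF, hF0⟩ := exists_latP_derivs hm
  have hB : ∀ θ ∈ Set.Ioo 0 Real.pi, latB n m θ = (lam n : ℂ)⁻¹ * F θ := fun θ hθ => by
    rw [latB, (hF θ hθ).1.deriv]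
  have hsC : ∀ θ ∈ Set.Ioo 0 Real.pi, (Real.sin θ : ℂ) ≠ 0 := fun θ hθ => by
    exact_mod_cast (sin_pos_of_mem hθ).ne'
  have hsd : ∀ θ : ℝ, HasDerivAt (fun t : ℝ => (Real.sin t : ℂ)) (Real.cos θ : ℂ) θ :=
    fun θ => (Real.hasDerivAt_sin θ).ofReal_comp
  have hinv : (lam n : ℂ)⁻¹ * ((n : ℂ) * (n + 1)) = lam n := by
    rcases eq_or_ne n 0 with rfl | hn
    · simp [lam_zero]
    · have := lam_ne_zero hn
      rw [← lam_sq]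
      field_simp
  have hf : ∀ θ ∈ Set.Ioo 0 Real.pi, HasDerivAt (latP n m) (lam n * latB n m θ) θ := by
    intro θ hθ
    refine (hF θ hθ).1.congr_deriv ?_
    rw [hB θ hθ]
    rcases eq_or_ne n 0 with rfl | hn
    · simp [hF0 rfl θ]
    · have := lam_ne_zero hn
      field_simp
  refine ⟨hf, fun θ hθ => ?_, fun θ hθ => ?_, fun θ hθ => ?_⟩
  · have h := (hF θ hθ).2.const_mul ((lam n : ℂ)⁻¹)
    refine (h.congr_of_eventuallyEq ?_).congr_deriv ?_
    · filter_upwards [isOpen_Ioo.mem_nhds hθ] with t ht using hB t ht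
    · rw [hB θ hθ, latC]
      linear_combination -(latP n m θ) * hinv
  · have hs := hsC θ hθ
    have h := (((hasDerivAt_const θ (m : ℂ)).div (hsd θ) hs).mul (hF θ hθ).1).const_mul
      ((lam n : ℂ)⁻¹)
    refine h.congr_deriv ?_
    rw [hB θ hθ, latC, Pi.div_apply]
    field_simp
    ring
  · rw [latC]
    have hs := hsC θ hθ
    rcases eq_or_ne n 0 with rfl | hn
    · have hm0 : m = 0 := by omega
      simp [hm0]
    · have := lam_ne_zero hn
      field_simp

/-- If `g = h` identically, the equations for `g'` and `h'` differ by `l f`, so `f` vanishes. -/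
lemma IsProfile.exists_sub_ne_zero {l m : ℂ} {f g h : ℝ → ℂ} (H : IsProfile l m f g h)
    (hl : l ≠ 0) (hf : ∃ θ ∈ Set.Ioo 0 Real.pi, f θ ≠ 0) :
    ∃ θ ∈ Set.Ioo 0 Real.pi, g θ - h θ ≠ 0 := by
  by_contra! hc
  obtain ⟨θ, hθ, hfθ⟩ := hf
  have h1 := (H.deriv_g θ hθ).sub (H.deriv_h θ hθ)
  have h2 : HasDerivAt (fun t => g t - h t) 0 θ :=
    (hasDerivAt_const θ (0 : ℂ)).congr_of_eventuallyEq (by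
      filter_upwards [isOpen_Ioo.mem_nhds hθ] with t ht using hc t ht)
  have h3 := h1.unique h2
  refine mul_ne_zero hl hfθ ?_
  linear_combination -h3 + (-(Real.cos θ / Real.sin θ : ℂ) - m / Real.sin θ) * hc θ hθ

lemma IsProfile.exists_add_ne_zero {l m : ℂ} {f g h : ℝ → ℂ} (H : IsProfile l m f g h)
    (hl : l ≠ 0) (hf : ∃ θ ∈ Set.Ioo 0 Real.pi, f θ ≠ 0) :
    ∃ θ ∈ Set.Ioo 0 Real.pi, g θ + h θ ≠ 0 := by
  -- Reversing the sign of the azimuthal order exchanges `h` and `-h`.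
  have H' : IsProfile l (-m) f g (fun t => -h t) :=
    ⟨H.deriv_f, fun θ hθ => (H.deriv_g θ hθ).congr_deriv (by ring),
      fun θ hθ => (H.deriv_h θ hθ).neg.congr_deriv (by ring),
      fun θ hθ => by linear_combination -H.constraint θ hθ⟩
  simpa using H'.exists_sub_ne_zero hl hf

/-! ### Transversely isotropic tensors -/

/-- The sixteen linear relations that single out the transversely isotropic tensors among the
elastic tensors. -/
structure TIRelations (C : Tensor4) : Prop where
  r0001 : C 0 0 0 1 = 0
  r0002 : C 0 0 0 2 = 0
  r0012 : C 0 0 1 2 = 0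
  r0022 : C 0 0 2 2 = C 0 0 1 1
  r0102 : C 0 1 0 2 = 0
  r0202 : C 0 2 0 2 = C 0 1 0 1
  r0111 : C 0 1 1 1 = 0
  r0122 : C 0 1 2 2 = 0
  r0112 : C 0 1 1 2 = 0
  r0211 : C 0 2 1 1 = 0
  r0222 : C 0 2 2 2 = 0
  r0212 : C 0 2 1 2 = 0
  r1112 : C 1 1 1 2 = 0
  r1222 : C 1 2 2 2 = 0
  r2222 : C 2 2 2 2 = C 1 1 1 1
  r1122 : C 1 1 2 2 = C 1 1 1 1 - 2 * C 1 2 1 2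

/-- The dyad `e_r ⊗ e_r`. -/
def radialDyad (i j : Fin 3) : ℂ := if i = 0 ∧ j = 0 then 1 else 0

/-- The projector `I - e_r ⊗ e_r` onto the tangent plane of the sphere. -/
def tangentProj (i j : Fin 3) : ℂ := if i = j ∧ i ≠ 0 then 1 else 0

/-- The elastic tensor with constants `c₁₁, c₁₂, c₂₂, c₄₄, c₆₆` and isotropy axis `e_r`, built from
`e_r ⊗ e_r` and the tangential projector. -/
def tiTensor (a₁₁ a₁₂ a₂₂ a₄₄ a₆₆ : ℂ) : Tensor4 := fun i j k l =>
  a₁₁ * (radialDyad i j * radialDyad k l)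
    + a₁₂ * (radialDyad i j * tangentProj k l) + a₁₂ * (tangentProj i j * radialDyad k l)
    + a₆₆ * (radialDyad i k * tangentProj j l) + a₆₆ * (tangentProj i k * radialDyad j l)
    + a₆₆ * (radialDyad i l * tangentProj j k) + a₆₆ * (tangentProj i l * radialDyad j k)
    + (a₂₂ - 2 * a₄₄) * (tangentProj i j * tangentProj k l)
    + a₄₄ * (tangentProj i k * tangentProj j l) + a₄₄ * (tangentProj i l * tangentProj j k)

lemma radialDyad_comm (i j : Fin 3) : radialDyad i j = radialDyad j i := by
  simp [radialDyad, and_comm]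

lemma tangentProj_comm (i j : Fin 3) : tangentProj i j = tangentProj j i := by
  fin_cases i <;> fin_cases j <;> simp [tangentProj]

lemma isElastic_tiTensor (a₁₁ a₁₂ a₂₂ a₄₄ a₆₆ : ℂ) :
    IsElastic (tiTensor a₁₁ a₁₂ a₂₂ a₄₄ a₆₆) := by
  refine ⟨fun i j k l => ?_, fun i j k l => ?_, fun i j k l => ?_⟩
  · simp only [tiTensor, radialDyad_comm j i, tangentProj_comm j i]
    ring
  · simp only [tiTensor, radialDyad_comm l k, tangentProj_comm l k]
    ring
  · simp only [tiTensor, radialDyad_comm k i, tangentProj_comm k i, radialDyad_comm l j,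
      tangentProj_comm l j, radialDyad_comm k j, tangentProj_comm k j, radialDyad_comm l i,
      tangentProj_comm l i]
    ring

/-- An elastic tensor is determined by its 21 components in canonical index order. -/
lemma IsElastic.ext_of_le {C D : Tensor4} (hC : IsElastic C) (hD : IsElastic D)
    (h : ∀ i j k l, i ≤ j → k ≤ l → (i < k ∨ i = k ∧ j ≤ l) → C i j k l = D i j k l) : C = D := by
  have h1 : ∀ i j k l, i ≤ j → k ≤ l → C i j k l = D i j k l := by
    intro i j k l hij hkl
    by_cases h2 : i < k ∨ i = k ∧ j ≤ l
    · exact h i j k l hij hkl h2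
    · rw [hC.major, hD.major]
      exact h k l i j hkl hij (by omega)
  have h2 : ∀ i j k l, i ≤ j → C i j k l = D i j k l := by
    intro i j k l hij
    rcases le_total k l with hkl | hkl
    · exact h1 i j k l hij hkl
    · rw [hC.minor_right, hD.minor_right]
      exact h1 i j l k hij hkl
  funext i j k l
  rcases le_total i j with hij | hij
  · exact h2 i j k l hij
  · rw [hC.minor_left, hD.minor_left]
    exact h2 j i k l hij

lemma TIRelations.eq_tiTensor {C : Tensor4} (H : TIRelations C) (hC : IsElastic C) :
    C = tiTensor (c11 C) (c12 C) (c22 C) (c44 C) (c66 C) := by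
  refine hC.ext_of_le (isElastic_tiTensor _ _ _ _ _) fun i j k l hij hkl h => ?_
  obtain ⟨h1, h2, h3, h4, h5, h6, h7, h8, h9, h10, h11, h12, h13, h14, h15, h16⟩ := H
  fin_cases i <;> fin_cases j <;> first
    | exact absurd hij (by decide)
    | (fin_cases k <;> fin_cases l <;> first
        | exact absurd hkl (by decide)
        | exact absurd h (by decide)
        | (simp [tiTensor, radialDyad, tangentProj, c11, c12, c22, c44, c66, *]; done)
        | (simp [tiTensor, radialDyad, tangentProj, c11, c12, c22, c44, c66, *]; ring))

/-- Invariance of a second-order tensor under the rotations about `e_r`. -/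
def RotInvariant (X : Fin 3 → Fin 3 → ℂ) : Prop :=
  ∀ (α : ℝ) (i j : Fin 3), ∑ a, ∑ b, ((rotR α i a * rotR α j b : ℝ) : ℂ) * X a b = X i j

lemma rotInvariant_radialDyad : RotInvariant radialDyad := by
  intro α i j
  fin_cases i <;> fin_cases j <;> simp [Fin.sum_univ_three, rotR, radialDyad]

lemma rotInvariant_tangentProj : RotInvariant tangentProj := by
  intro α i j
  have h : (Complex.cos α) ^ 2 + Complex.sin α ^ 2 = 1 := Complex.cos_sq_add_sin_sq _
  fin_cases i <;> fin_cases j <;> simp [Fin.sum_univ_three, rotR, tangentProj] <;> first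
    | linear_combination h
    | ring

lemma IsTI.add {C D : Tensor4} (hC : IsTI C) (hD : IsTI D) :
    IsTI (fun i j k l => C i j k l + D i j k l) := by
  intro α i j k l
  simp only [mul_add, Finset.sum_add_distrib]
  rw [hC α i j k l, hD α i j k l]

lemma IsTI.const_mul {C : Tensor4} (hC : IsTI C) (a : ℂ) :
    IsTI (fun i j k l => a * C i j k l) := by
  intro α i j k l
  simp only [mul_left_comm _ a, ← Finset.mul_sum]
  rw [hC α i j k l]

lemma isTI_mul₁₂ {X Y : Fin 3 → Fin 3 → ℂ} (hX : RotInvariant X) (hY : RotInvariant Y) :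
    IsTI (fun i j k l => X i j * Y k l) := by
  intro α i j k l
  change _ = X i j * Y k l
  rw [← hX α i j, ← hY α k l]
  simp only [Finset.sum_mul]
  simp only [Finset.mul_sum]
  refine Finset.sum_congr rfl fun a _ => Finset.sum_congr rfl fun b _ =>
    Finset.sum_congr rfl fun c _ => Finset.sum_congr rfl fun d _ => ?_
  push_cast
  ring

lemma isTI_mul₁₃ {X Y : Fin 3 → Fin 3 → ℂ} (hX : RotInvariant X) (hY : RotInvariant Y) :
    IsTI (fun i j k l => X i k * Y j l) := by
  intro α i j k l
  refine Eq.trans ?_ (isTI_mul₁₂ hX hY α i k j l)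
  refine Finset.sum_congr rfl fun a _ => ?_
  rw [Finset.sum_comm]
  refine Finset.sum_congr rfl fun b _ => Finset.sum_congr rfl fun c _ =>
    Finset.sum_congr rfl fun d _ => ?_
  push_cast
  ring

lemma isTI_mul₁₄ {X Y : Fin 3 → Fin 3 → ℂ} (hX : RotInvariant X) (hY : RotInvariant Y) :
    IsTI (fun i j k l => X i l * Y j k) := by
  intro α i j k l
  refine Eq.trans ?_ (isTI_mul₁₃ hX hY α i j l k)
  refine Finset.sum_congr rfl fun a _ => Finset.sum_congr rfl fun b _ => ?_
  rw [Finset.sum_comm]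
  refine Finset.sum_congr rfl fun c _ => Finset.sum_congr rfl fun d _ => ?_
  push_cast
  ring

lemma isTI_tiTensor (a₁₁ a₁₂ a₂₂ a₄₄ a₆₆ : ℂ) : IsTI (tiTensor a₁₁ a₁₂ a₂₂ a₄₄ a₆₆) := by
  have hn := rotInvariant_radialDyad
  have hp := rotInvariant_tangentProj
  unfold tiTensor
  iterate 9 refine IsTI.add ?_ ?_
  all_goals refine IsTI.const_mul ?_ _
  · exact isTI_mul₁₂ hn hn
  · exact isTI_mul₁₂ hn hp
  · exact isTI_mul₁₂ hp hn
  · exact isTI_mul₁₃ hn hp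
  · exact isTI_mul₁₃ hp hn
  · exact isTI_mul₁₄ hn hp
  · exact isTI_mul₁₄ hp hn
  · exact isTI_mul₁₂ hp hp
  · exact isTI_mul₁₃ hp hp
  · exact isTI_mul₁₄ hp hp

lemma TIRelations.isTI {C : Tensor4} (H : TIRelations C) (hC : IsElastic C) : IsTI C := by
  rw [H.eq_tiTensor hC]
  exact isTI_tiTensor _ _ _ _ _

/-- The relations follow from three rotations. Those by `π` and `π/2` reduce the tensor to tetragonal symmetry; the rotation by `π/4`
gives the relations that are left. -/
lemma IsTI.tiRelations {C : Tensor4} (H : IsTI C) (hC : IsElastic C) : TIRelations C := by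
  have hπ := H Real.pi
  have hh := H (Real.pi / 2)
  have a1 := hπ 0 0 0 1
  have a2 := hπ 0 0 0 2
  have a3 := hπ 0 1 1 1
  have a4 := hπ 0 1 2 2
  have a5 := hπ 0 1 1 2
  have a6 := hπ 0 2 1 1
  have a7 := hπ 0 2 2 2
  have a8 := hπ 0 2 1 2
  have b1 := hh 0 0 1 1
  have b2 := hh 0 0 1 2
  have b3 := hh 0 1 0 1
  have b4 := hh 0 1 0 2
  have b5 := hh 1 1 1 1
  have b6 := hh 1 1 1 2
  have e1 := H (Real.pi / 4) 1 1 1 1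
  have e2 := H (Real.pi / 4) 1 1 1 2
  clear hπ hh H
  simp [Fin.sum_univ_three, rotR] at a1 a2 a3 a4 a5 a6 a7 a8 b1 b2 b3 b4 b5 b6
  simp only [Fin.sum_univ_three, rotR, Real.cos_pi_div_four, Real.sin_pi_div_four] at e1 e2
  simp at e1 e2
  have hw4 : (√2 / 2 : ℂ) ^ 4 = 1 / 4 := by
    have h : (√2 : ℝ) ^ 4 = 4 := by
      rw [show 4 = 2 * 2 from rfl, pow_mul, Real.sq_sqrt (by norm_num)]
      norm_num
    have h' : (√2 : ℂ) ^ 4 = 4 := by exact_mod_cast h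
    rw [div_pow, h']
    norm_num
  have s1 : C 1 2 1 1 = C 1 1 1 2 := hC.major _ _ _ _
  have s2 : C 2 2 1 1 = C 1 1 2 2 := hC.major _ _ _ _
  have s3 : C 2 2 1 2 = C 1 2 2 2 := hC.major _ _ _ _
  have b6 : -C 1 2 2 2 = C 1 1 1 2 := by rw [← s3, ← hC.minor_right 2 2 2 1, b6]
  simp only [hC.minor_left 2 1, hC.minor_right _ _ 2 1, s1, s2, s3] at e1 e2
  have hM : C 1 1 1 2 = 0 := by
    linear_combination (-1 / 2) * e2 - (1 / 4) * b6
      + (1 / 2) * (C 1 1 1 1 - 2 * C 1 1 1 2 + 2 * C 1 2 2 2 - C 2 2 2 2) * hw4 + (-1 / 8) * b5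
  refine ⟨?_, ?_, ?_, b1, ?_, b3, ?_, ?_, ?_, ?_, ?_, ?_, hM, ?_, b5, ?_⟩
  · linear_combination (-1 / 2) * a1
  · linear_combination (-1 / 2) * a2
  · linear_combination (-1 / 2) * b2 + (1 / 2) * hC.minor_right 0 0 1 2
  · linear_combination (-1 / 2) * b4 + (1 / 2) * hC.major 0 1 0 2
  · linear_combination (-1 / 2) * a3
  · linear_combination (-1 / 2) * a4
  · linear_combination (-1 / 2) * a5
  · linear_combination (-1 / 2) * a6
  · linear_combination (-1 / 2) * a7
  · linear_combination (-1 / 2) * a8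
  · linear_combination -b6 - hM
  · linear_combination 2 * e1 - 2 * (C 1 1 1 1 - 4 * C 1 1 1 2 + 2 * C 1 1 2 2 + 4 * C 1 2 1 2
      - 4 * C 1 2 2 2 + C 2 2 2 2) * hw4 - (1 / 2) * b5 - 2 * b6

/-! ### Strain, tractions and `τ` of a separated displacement -/

/-- The field `∑_A a_A A` on the sphere. -/
def synth (n : ℕ) (m : ℤ) (a : Fin 3 → ℂ) (θ φ : ℝ) : Fin 3 → ℂ :=
  a 0 • harmP n m θ φ + a 1 • harmB n m θ φ + a 2 • harmC n m θ φ

lemma expand_apply (n : ℕ) (m : ℤ) (V : ℝ → Fin 3 → ℂ) (r θ φ : ℝ) :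
    expand n m V r θ φ = synth n m (V r) θ φ := rfl

/-- The latitudinal profile of `∑_A a_A A`. -/
def latVec (n : ℕ) (m : ℤ) (a : Fin 3 → ℂ) (θ : ℝ) : Fin 3 → ℂ :=
  ![a 0 * latP n m θ,
    a 1 * latB n m θ + a 2 * (Complex.I * latC n m θ),
    a 1 * (Complex.I * latC n m θ) - a 2 * latB n m θ]

lemma synth_eq (n : ℕ) (m : ℤ) (a : Fin 3 → ℂ) (θ φ : ℝ) (j : Fin 3) :
    synth n m a θ φ j = azim m φ * latVec n m a θ j := by
  simp only [synth, harmP_eq, harmB_eq, harmC_eq]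
  fin_cases j <;> simp [latVec] <;> ring

/-- The derivative of `latB`, according to `IsProfile`. -/
def latB' (n : ℕ) (m : ℤ) (θ : ℝ) : ℂ :=
  -(Real.cos θ / Real.sin θ) * latB n m θ - lam n * latP n m θ + m / Real.sin θ * latC n m θ

/-- The derivative of `latC`, according to `IsProfile`. -/
def latC' (n : ℕ) (m : ℤ) (θ : ℝ) : ℂ :=
  m / Real.sin θ * latB n m θ - Real.cos θ / Real.sin θ * latC n m θ

/-- The derivative of `latB'`. -/
def latB'' (n : ℕ) (m : ℤ) (θ : ℝ) : ℂ :=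
  (m * latC' n m θ - 2 * Real.cos θ * latB' n m θ - lam n * Real.cos θ * latP n m θ)
    / Real.sin θ + (1 - (lam n : ℂ) ^ 2) * latB n m θ

/-- The derivative of `latC'`. -/
def latC'' (n : ℕ) (m : ℤ) (θ : ℝ) : ℂ :=
  (m * latB' n m θ - 2 * Real.cos θ * latC' n m θ) / Real.sin θ + latC n m θ

lemma sin_ne_zero_of_mem {θ : ℝ} (hθ : θ ∈ Set.Ioo 0 Real.pi) : (Real.sin θ : ℂ) ≠ 0 := by
  exact_mod_cast (sin_pos_of_mem hθ).ne'

lemma hasDerivAt_ofReal_sin (θ : ℝ) :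
    HasDerivAt (fun t : ℝ => (Real.sin t : ℂ)) (Real.cos θ : ℂ) θ :=
  (Real.hasDerivAt_sin θ).ofReal_comp

lemma hasDerivAt_ofReal_cos (θ : ℝ) :
    HasDerivAt (fun t : ℝ => (Real.cos t : ℂ)) (-Real.sin θ : ℂ) θ := by
  simpa using (Real.hasDerivAt_cos θ).ofReal_comp

lemma sin_sq_add_cos_sq_ofReal (θ : ℝ) : (Real.sin θ : ℂ) ^ 2 + (Real.cos θ : ℂ) ^ 2 = 1 := by
  exact_mod_cast Real.sin_sq_add_cos_sq θ

section Profiles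

variable {n : ℕ} {m : ℤ} {θ : ℝ}

lemma hasDerivAt_latP (hm : m.natAbs ≤ n) (hθ : θ ∈ Set.Ioo 0 Real.pi) :
    HasDerivAt (latP n m) (lam n * latB n m θ) θ := (isProfile_lat hm).deriv_f θ hθ

lemma hasDerivAt_latB (hm : m.natAbs ≤ n) (hθ : θ ∈ Set.Ioo 0 Real.pi) :
    HasDerivAt (latB n m) (latB' n m θ) θ := (isProfile_lat hm).deriv_g θ hθ

lemma hasDerivAt_latC (hm : m.natAbs ≤ n) (hθ : θ ∈ Set.Ioo 0 Real.pi) :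
    HasDerivAt (latC n m) (latC' n m θ) θ := (isProfile_lat hm).deriv_h θ hθ

lemma hasDerivAt_latB' (hm : m.natAbs ≤ n) (hθ : θ ∈ Set.Ioo 0 Real.pi) :
    HasDerivAt (latB' n m) (latB'' n m θ) θ := by
  have hs := sin_ne_zero_of_mem hθ
  have h := ((((hasDerivAt_ofReal_cos θ).div (hasDerivAt_ofReal_sin θ) hs).neg.mul
    (hasDerivAt_latB hm hθ)).sub ((hasDerivAt_latP hm hθ).const_mul (lam n : ℂ))).add
    (((hasDerivAt_const θ (m : ℂ)).div (hasDerivAt_ofReal_sin θ) hs).mul (hasDerivAt_latC hm hθ))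
  refine h.congr_deriv ?_
  simp only [latB'', latB', latC', Pi.neg_apply, Pi.div_apply]
  field_simp
  ring

lemma hasDerivAt_latC' (hm : m.natAbs ≤ n) (hθ : θ ∈ Set.Ioo 0 Real.pi) :
    HasDerivAt (latC' n m) (latC'' n m θ) θ := by
  have hs := sin_ne_zero_of_mem hθ
  have h := (((hasDerivAt_const θ (m : ℂ)).div (hasDerivAt_ofReal_sin θ) hs).mul
    (hasDerivAt_latB hm hθ)).sub
    (((hasDerivAt_ofReal_cos θ).div (hasDerivAt_ofReal_sin θ) hs).mul (hasDerivAt_latC hm hθ))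
  refine h.congr_deriv ?_
  simp only [latC'', latB', latC', Pi.div_apply]
  field_simp
  ring

end Profiles

/-- The strain produced at radius `r` by amplitudes with values `U` and derivatives `V`, as a linear
function of the profiles `f, g, h` of the harmonic and the derivatives `g₁, h₁` of `g, h`.
The factors `cos θ / sin θ` and `m / sin θ` of the spherical strain components are absorbed
by the relations `IsProfile`. -/
def strainForm (l : ℂ) (r : ℝ) (U V : Fin 3 → ℂ) (f g h g₁ h₁ : ℂ) : Matrix (Fin 3) (Fin 3) ℂ :=
  let s01 := ((V 1 + (r : ℂ)⁻¹ * (l * U 0 - U 1)) * g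
    + Complex.I * (V 2 - (r : ℂ)⁻¹ * U 2) * h) / 2
  let s02 := (Complex.I * (V 1 + (r : ℂ)⁻¹ * (l * U 0 - U 1)) * h
    - (V 2 - (r : ℂ)⁻¹ * U 2) * g) / 2
  let s12 := (r : ℂ)⁻¹ * (2 * Complex.I * U 1 * h₁ - U 2 * (2 * g₁ + l * f)) / 2
  !![V 0 * f, s01, s02;
     s01, (r : ℂ)⁻¹ * (U 1 * g₁ + Complex.I * U 2 * h₁ + U 0 * f), s12;
     s02, s12, (r : ℂ)⁻¹ * (-(U 1 * (l * f + g₁)) - Complex.I * U 2 * h₁ + U 0 * f)]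

lemma hasDerivAt_strainForm {l : ℂ} {r : ℝ} {U V : Fin 3 → ℂ} {f g h g₁ h₁ : ℝ → ℂ}
    {f' g' h' g₁' h₁' : ℂ} {θ : ℝ} (hf : HasDerivAt f f' θ) (hg : HasDerivAt g g' θ)
    (hh : HasDerivAt h h' θ) (hg₁ : HasDerivAt g₁ g₁' θ) (hh₁ : HasDerivAt h₁ h₁' θ)
    (i j : Fin 3) :
    HasDerivAt (fun t => strainForm l r U V (f t) (g t) (h t) (g₁ t) (h₁ t) i j)
      (strainForm l r U V f' g' h' g₁' h₁' i j) θ := by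
  have h01 := ((hg.const_mul (V 1 + (r : ℂ)⁻¹ * (l * U 0 - U 1))).add
    (hh.const_mul (Complex.I * (V 2 - (r : ℂ)⁻¹ * U 2)))).div_const 2
  have h02 := ((hh.const_mul (Complex.I * (V 1 + (r : ℂ)⁻¹ * (l * U 0 - U 1)))).sub
    (hg.const_mul (V 2 - (r : ℂ)⁻¹ * U 2))).div_const 2
  have h12 := (((hh₁.const_mul (2 * Complex.I * U 1)).sub
    (((hg₁.const_mul 2).add (hf.const_mul l)).const_mul (U 2))).const_mul (r : ℂ)⁻¹).div_const 2
  have h11 := (((hg₁.const_mul (U 1)).add (hh₁.const_mul (Complex.I * U 2))).add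
    (hf.const_mul (U 0))).const_mul (r : ℂ)⁻¹
  have h22 := (((((hf.const_mul l).add hg₁).const_mul (U 1)).neg.sub
    (hh₁.const_mul (Complex.I * U 2))).add (hf.const_mul (U 0))).const_mul (r : ℂ)⁻¹
  fin_cases i <;> fin_cases j
  exacts [hf.const_mul (V 0), h01, h02, h01, h11, h12, h02, h12, h22]

/-- The strain of `∑_A U_A A`, without the azimuthal factor. -/
def latStrain (n : ℕ) (m : ℤ) (r : ℝ) (U V : Fin 3 → ℂ) (θ : ℝ) : Matrix (Fin 3) (Fin 3) ℂ :=
  strainForm (lam n) r U V (latP n m θ) (latB n m θ) (latC n m θ) (latB' n m θ) (latC' n m θ)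

/-- The `θ`-derivative of `latStrain`. -/
def latStrain' (n : ℕ) (m : ℤ) (r : ℝ) (U V : Fin 3 → ℂ) (θ : ℝ) : Matrix (Fin 3) (Fin 3) ℂ :=
  strainForm (lam n) r U V (lam n * latB n m θ) (latB' n m θ) (latC' n m θ) (latB'' n m θ)
    (latC'' n m θ)

lemma hasDerivAt_latStrain {n : ℕ} {m : ℤ} (hm : m.natAbs ≤ n) (r : ℝ) (U V : Fin 3 → ℂ) {θ : ℝ}
    (hθ : θ ∈ Set.Ioo 0 Real.pi) (i j : Fin 3) :
    HasDerivAt (fun t => latStrain n m r U V t i j) (latStrain' n m r U V θ i j) θ :=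
  hasDerivAt_strainForm (hasDerivAt_latP hm hθ) (hasDerivAt_latB hm hθ) (hasDerivAt_latC hm hθ)
    (hasDerivAt_latB' hm hθ) (hasDerivAt_latC' hm hθ) i j

lemma hasDerivAt_synth {n : ℕ} {m : ℤ} {U : ℝ → Fin 3 → ℂ} {V : Fin 3 → ℂ} {r : ℝ}
    (hU : HasDerivAt U V r) (θ φ : ℝ) (j : Fin 3) :
    HasDerivAt (fun s => synth n m (U s) θ φ j) (synth n m V θ φ j) r := by
  have h := fun i => hasDerivAt_pi.1 hU i
  have := (((h 0).mul_const (harmP n m θ φ j)).add ((h 1).mul_const (harmB n m θ φ j))).add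
    ((h 2).mul_const (harmC n m θ φ j))
  exact this

lemma hasDerivAt_latVec {n : ℕ} {m : ℤ} (hm : m.natAbs ≤ n) (a : Fin 3 → ℂ) {θ : ℝ}
    (hθ : θ ∈ Set.Ioo 0 Real.pi) (j : Fin 3) :
    HasDerivAt (fun t => latVec n m a t j)
      (![a 0 * (lam n * latB n m θ),
        a 1 * latB' n m θ + a 2 * (Complex.I * latC' n m θ),
        a 1 * (Complex.I * latC' n m θ) - a 2 * latB' n m θ] j) θ := by
  have hf := hasDerivAt_latP hm hθ
  have hg := hasDerivAt_latB hm hθ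
  have hh := (hasDerivAt_latC hm hθ).const_mul Complex.I
  fin_cases j
  exacts [hf.const_mul (a 0), (hg.const_mul (a 1)).add (hh.const_mul (a 2)),
    (hh.const_mul (a 1)).sub (hg.const_mul (a 2))]

lemma hasDerivAt_synth_theta {n : ℕ} {m : ℤ} (hm : m.natAbs ≤ n) (a : Fin 3 → ℂ) {θ : ℝ}
    (hθ : θ ∈ Set.Ioo 0 Real.pi) (φ : ℝ) (j : Fin 3) :
    HasDerivAt (fun t => synth n m a t φ j)
      (azim m φ * ![a 0 * (lam n * latB n m θ),
        a 1 * latB' n m θ + a 2 * (Complex.I * latC' n m θ),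
        a 1 * (Complex.I * latC' n m θ) - a 2 * latB' n m θ] j) θ := by
  simp only [synth_eq]
  exact (hasDerivAt_latVec hm a hθ j).const_mul _

lemma hasDerivAt_synth_phi (n : ℕ) (m : ℤ) (a : Fin 3 → ℂ) (θ φ : ℝ) (j : Fin 3) :
    HasDerivAt (fun p => synth n m a θ p j) (Complex.I * m * synth n m a θ φ j) φ := by
  simp only [synth_eq]
  exact ((hasDerivAt_azim m φ).mul_const _).congr_deriv (by ring)

/-- The displacement gradient of `∑_A U_A A`, without the azimuthal factor. -/
def latGrad (n : ℕ) (m : ℤ) (r : ℝ) (U V : Fin 3 → ℂ) (θ : ℝ) : Matrix (Fin 3) (Fin 3) ℂ :=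
  !![latVec n m V θ 0, latVec n m V θ 1, latVec n m V θ 2;
    (r : ℂ)⁻¹ * (U 0 * (lam n * latB n m θ) - latVec n m U θ 1),
      (r : ℂ)⁻¹ * (U 1 * latB' n m θ + U 2 * (Complex.I * latC' n m θ) + U 0 * latP n m θ),
      (r : ℂ)⁻¹ * (U 1 * (Complex.I * latC' n m θ) - U 2 * latB' n m θ);
    (r : ℂ)⁻¹ * (Complex.I * lam n * U 0 * latC n m θ - latVec n m U θ 2),
      (r : ℂ)⁻¹ * (Complex.I * U 1 * latC' n m θ - U 2 * (latB' n m θ + lam n * latP n m θ)),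
      (r : ℂ)⁻¹ * (-(U 1 * (lam n * latP n m θ + latB' n m θ)) - Complex.I * U 2 * latC' n m θ
        + U 0 * latP n m θ)]

lemma grad_expand {n : ℕ} {m : ℤ} (hm : m.natAbs ≤ n) {U : ℝ → Fin 3 → ℂ} {V : Fin 3 → ℂ}
    {r : ℝ} (hU : HasDerivAt U V r) {θ : ℝ} (hθ : θ ∈ Set.Ioo 0 Real.pi) (φ : ℝ)
    (i j : Fin 3) :
    grad (expand n m U) r θ φ i j = azim m φ * latGrad n m r (U r) V θ i j := by
  have hs := sin_ne_zero_of_mem hθ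
  have hcon : (m : ℂ) * latP n m θ = _ := (isProfile_lat hm).constraint θ hθ
  have hI := Complex.I_sq
  have e0 : latVec n m (U r) θ 0 = U r 0 * latP n m θ := rfl
  have e1 : latVec n m (U r) θ 1 = U r 1 * latB n m θ + U r 2 * (Complex.I * latC n m θ) := rfl
  have e2 : latVec n m (U r) θ 2 = U r 1 * (Complex.I * latC n m θ) - U r 2 * latB n m θ := rfl
  have hr : ∀ j, deriv (fun s => synth n m (U s) θ φ j) r = azim m φ * latVec n m V θ j :=
    fun j => by rw [(hasDerivAt_synth hU θ φ j).deriv, synth_eq]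
  have ht := fun j => (hasDerivAt_synth_theta hm (U r) hθ φ j).deriv
  have hp := fun j => (hasDerivAt_synth_phi n m (U r) θ φ j).deriv
  have hK : ∀ a : Fin 3 → ℂ, matK *ᵥ a = ![-a 1, a 0, 0] := fun a => by
    ext j
    fin_cases j <;> simp [matK, Matrix.mulVec, dotProduct, Fin.sum_univ_three]
  have hH : ∀ a : Fin 3 → ℂ, matH θ *ᵥ a = ![-(Real.sin θ * a 2), -(Real.cos θ * a 2),
      Real.sin θ * a 0 + Real.cos θ * a 1] := fun a => by
    ext j
    fin_cases j <;> simp [matH, Matrix.mulVec, dotProduct, Fin.sum_univ_three]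
  have h20 : Complex.I * m * latVec n m (U r) θ 0 = Real.sin θ *
      (Complex.I * lam n * U r 0 * latC n m θ) := by
    rw [e0]
    linear_combination (Complex.I * U r 0) * hcon
  have h21 : Complex.I * m * latVec n m (U r) θ 1 - Real.cos θ * latVec n m (U r) θ 2
      = Real.sin θ * (Complex.I * U r 1 * latC' n m θ
        - U r 2 * (latB' n m θ + lam n * latP n m θ)) := by
    simp only [e1, e2, latB', latC']
    field_simp
    linear_combination (m * U r 2 * latC n m θ) * hI
  have h22 : Complex.I * m * latVec n m (U r) θ 2 + Real.sin θ * latVec n m (U r) θ 0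
      + Real.cos θ * latVec n m (U r) θ 1 = Real.sin θ *
      (-(U r 1 * (lam n * latP n m θ + latB' n m θ)) - Complex.I * U r 2 * latC' n m θ
        + U r 0 * latP n m θ) := by
    simp only [e0, e1, e2, latB', latC']
    field_simp
    linear_combination (m * U r 1 * latC n m θ) * hI
  have hsc : ∀ x : ℂ, ((r * Real.sin θ : ℝ) : ℂ)⁻¹ * (azim m φ * (Real.sin θ * x))
      = azim m φ * ((r : ℂ)⁻¹ * x) := fun x => by
    push_cast [-Complex.ofReal_sin]
    field_simp
  fin_cases i <;> fin_cases j
  · exact hr 0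
  · exact hr 1
  · exact hr 2
  · change (r : ℂ)⁻¹ * (deriv (fun t => synth n m (U r) t φ 0) θ
      + (matK *ᵥ synth n m (U r) θ φ) 0) = azim m φ * ((r : ℂ)⁻¹ * _)
    rw [ht, hK]
    simp only [synth_eq, Matrix.cons_val]
    ring
  · change (r : ℂ)⁻¹ * (deriv (fun t => synth n m (U r) t φ 1) θ
      + (matK *ᵥ synth n m (U r) θ φ) 1) = azim m φ * ((r : ℂ)⁻¹ * _)
    rw [ht, hK]
    simp only [synth_eq, Matrix.cons_val, e0]
    ring
  · change (r : ℂ)⁻¹ * (deriv (fun t => synth n m (U r) t φ 2) θ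
      + (matK *ᵥ synth n m (U r) θ φ) 2) = azim m φ * ((r : ℂ)⁻¹ * _)
    rw [ht, hK]
    simp only [Matrix.cons_val]
    ring
  · change _ * (deriv (fun p => synth n m (U r) θ p 0) φ
      + (matH θ *ᵥ synth n m (U r) θ φ) 0) = azim m φ * ((r : ℂ)⁻¹ * _)
    rw [hp, hH, ← hsc]
    simp only [synth_eq, Matrix.cons_val]
    linear_combination (((r * Real.sin θ : ℝ) : ℂ)⁻¹ * azim m φ) * h20
  · change _ * (deriv (fun p => synth n m (U r) θ p 1) φ
      + (matH θ *ᵥ synth n m (U r) θ φ) 1) = azim m φ * ((r : ℂ)⁻¹ * _)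
    rw [hp, hH, ← hsc]
    simp only [synth_eq, Matrix.cons_val]
    linear_combination (((r * Real.sin θ : ℝ) : ℂ)⁻¹ * azim m φ) * h21
  · change _ * (deriv (fun p => synth n m (U r) θ p 2) φ
      + (matH θ *ᵥ synth n m (U r) θ φ) 2) = azim m φ * ((r : ℂ)⁻¹ * _)
    rw [hp, hH, ← hsc]
    simp only [synth_eq, Matrix.cons_val]
    linear_combination (((r * Real.sin θ : ℝ) : ℂ)⁻¹ * azim m φ) * h22

lemma strain_expand {n : ℕ} {m : ℤ} (hm : m.natAbs ≤ n) {U : ℝ → Fin 3 → ℂ} {V : Fin 3 → ℂ}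
    {r : ℝ} (hU : HasDerivAt U V r) {θ : ℝ} (hθ : θ ∈ Set.Ioo 0 Real.pi) (φ : ℝ)
    (k l : Fin 3) :
    strain (expand n m U) r θ φ k l = azim m φ * latStrain n m r (U r) V θ k l := by
  simp only [strain, grad_expand hm hU hθ, latStrain, strainForm, latGrad]
  fin_cases k <;> fin_cases l <;> simp [latVec, -mul_eq_mul_left_iff] <;> ring

/-- The stress `σ_{ij} = C_{ijkl} S_{kl}`. -/
def stress (C : Tensor4) (S : Matrix (Fin 3) (Fin 3) ℂ) (i : Fin 3) : Fin 3 → ℂ := fun j =>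
  ∑ k, ∑ l, C i j k l * S k l

lemma traction_expand {n : ℕ} {m : ℤ} (hm : m.natAbs ≤ n) (c : ℝ → Tensor4) {U : ℝ → Fin 3 → ℂ}
    {V : Fin 3 → ℂ} {r : ℝ} (hU : HasDerivAt U V r) {θ : ℝ} (hθ : θ ∈ Set.Ioo 0 Real.pi) (φ : ℝ)
    (i j : Fin 3) :
    traction c (expand n m U) i r θ φ j
      = azim m φ * stress (c r) (latStrain n m r (U r) V θ) i j := by
  simp only [traction, stress, strain_expand hm hU hθ, Finset.mul_sum]
  refine Finset.sum_congr rfl fun k _ => Finset.sum_congr rfl fun l _ => ?_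
  ring

lemma hasDerivAt_stress {C : Tensor4} {S : ℝ → Matrix (Fin 3) (Fin 3) ℂ}
    {S' : Matrix (Fin 3) (Fin 3) ℂ} {θ : ℝ} (hS : ∀ i j, HasDerivAt (fun t => S t i j) (S' i j) θ)
    (i j : Fin 3) : HasDerivAt (fun t => stress C (S t) i j) (stress C S' i j) θ := by
  unfold stress
  exact HasDerivAt.fun_sum fun k _ => HasDerivAt.fun_sum fun l _ => (hS k l).const_mul _

/-- `sin θ τ` without the azimuthal factor, as a function of the tractions `t_θ`, `t_φ` and of
the derivative `t_θ'`. -/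
def tauForm (m : ℤ) (θ : ℝ) (t₁ t₁' t₂ : Fin 3 → ℂ) : Fin 3 → ℂ :=
  ![Real.cos θ * t₁ 0 + Real.sin θ * t₁' 0 + Complex.I * m * t₂ 0
      - Real.sin θ * t₁ 1 - Real.sin θ * t₂ 2,
    Real.cos θ * t₁ 1 + Real.sin θ * t₁' 1 + Complex.I * m * t₂ 1
      + Real.sin θ * t₁ 0 - Real.cos θ * t₂ 2,
    Real.cos θ * t₁ 2 + Real.sin θ * t₁' 2 + Complex.I * m * t₂ 2
      + Real.sin θ * t₂ 0 + Real.cos θ * t₂ 1]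

section Tau

variable {n : ℕ} {m : ℤ} {U : ℝ → Fin 3 → ℂ} {V : Fin 3 → ℂ} {r θ : ℝ}

lemma hasDerivAt_sin_mul_traction (hm : m.natAbs ≤ n) (c : ℝ → Tensor4)
    (hU : HasDerivAt U V r) (hθ : θ ∈ Set.Ioo 0 Real.pi) (φ : ℝ) (j : Fin 3) :
    HasDerivAt (fun t : ℝ => (Real.sin t : ℂ) * traction c (expand n m U) 1 r t φ j)
      (azim m φ * (Real.cos θ * stress (c r) (latStrain n m r (U r) V θ) 1 j
        + Real.sin θ * stress (c r) (latStrain' n m r (U r) V θ) 1 j)) θ := by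
  have h := ((hasDerivAt_ofReal_sin θ).mul (hasDerivAt_stress (C := c r)
    (hasDerivAt_latStrain hm r (U r) V hθ) 1 j)).const_mul (azim m φ)
  refine h.congr_of_eventuallyEq ?_
  filter_upwards [isOpen_Ioo.mem_nhds hθ] with t ht
  rw [traction_expand hm c hU ht]
  simp only [Pi.mul_apply]
  ring

lemma hasDerivAt_traction_phi (hm : m.natAbs ≤ n) (c : ℝ → Tensor4)
    (hU : HasDerivAt U V r) (hθ : θ ∈ Set.Ioo 0 Real.pi) (φ : ℝ) (j : Fin 3) :
    HasDerivAt (fun p : ℝ => traction c (expand n m U) 2 r θ p j)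
      (azim m φ * (Complex.I * m * stress (c r) (latStrain n m r (U r) V θ) 2 j)) φ := by
  simp only [traction_expand hm c hU hθ]
  exact ((hasDerivAt_azim m φ).mul_const _).congr_deriv (by ring)

lemma tau_expand (hm : m.natAbs ≤ n) (c : ℝ → Tensor4)
    (hU : HasDerivAt U V r) (hθ : θ ∈ Set.Ioo 0 Real.pi) (φ : ℝ) (j : Fin 3) :
    tau c (expand n m U) r θ φ j = azim m φ * ((Real.sin θ : ℂ)⁻¹ *
      tauForm m θ (stress (c r) (latStrain n m r (U r) V θ) 1)
        (stress (c r) (latStrain' n m r (U r) V θ) 1)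
        (stress (c r) (latStrain n m r (U r) V θ) 2) j) := by
  rw [tau, (hasDerivAt_sin_mul_traction hm c hU hθ φ j).deriv,
    (hasDerivAt_traction_phi hm c hU hθ φ j).deriv]
  have h1 : ∀ i, traction c (expand n m U) i r θ φ
      = fun j => azim m φ * stress (c r) (latStrain n m r (U r) V θ) i j :=
    fun i => funext fun j => traction_expand hm c hU hθ φ i j
  rw [h1, h1]
  fin_cases j <;>
    simp [matK, matH, tauForm, Matrix.mulVec, dotProduct, Fin.sum_univ_three,
      -Complex.ofReal_sin, -Complex.ofReal_cos] <;> ring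

end Tau

/-! ### Separation for transversely isotropic materials -/

lemma TIRelations.stress_eq {C : Tensor4} (H : TIRelations C) (hC : IsElastic C)
    (S : Matrix (Fin 3) (Fin 3) ℂ) (hS : Sᵀ = S) :
    Matrix.of (stress C S) =
      !![c11 C * S 0 0 + c12 C * (S 1 1 + S 2 2), 2 * c66 C * S 0 1, 2 * c66 C * S 0 2;
        2 * c66 C * S 0 1, c12 C * S 0 0 + c22 C * S 1 1 + (c22 C - 2 * c44 C) * S 2 2,
          2 * c44 C * S 1 2;
        2 * c66 C * S 0 2, 2 * c44 C * S 1 2,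
          c12 C * S 0 0 + (c22 C - 2 * c44 C) * S 1 1 + c22 C * S 2 2] := by
  have h10 : S 1 0 = S 0 1 := congrFun₂ hS 0 1
  have h20 : S 2 0 = S 0 2 := congrFun₂ hS 0 2
  have h21 : S 2 1 = S 1 2 := congrFun₂ hS 1 2
  conv_lhs => rw [H.eq_tiTensor hC]
  ext i j
  fin_cases i <;> fin_cases j <;>
    simp [stress, Fin.sum_univ_three, tiTensor, radialDyad, tangentProj, h10, h20, h21,
      -mul_eq_mul_right_iff] <;> ring

lemma strainForm_transpose (l : ℂ) (r : ℝ) (U V : Fin 3 → ℂ) (f g h g₁ h₁ : ℂ) :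
    (strainForm l r U V f g h g₁ h₁)ᵀ = strainForm l r U V f g h g₁ h₁ := by
  ext i j
  fin_cases i <;> fin_cases j <;> rfl

/-- The amplitudes `𝒯 U' + r⁻¹ ℛᵀ U` of the radial traction. -/
def tractionAmp (C : Tensor4) (n : ℕ) (r : ℝ) (U V : Fin 3 → ℂ) : Fin 3 → ℂ :=
  matT C *ᵥ V + (r : ℂ)⁻¹ • ((matR C n)ᵀ *ᵥ U)

/-- The amplitudes `-r⁻¹ 𝒬 U - ℛ U'` of `τ`. -/
def tauAmp (C : Tensor4) (n : ℕ) (r : ℝ) (U V : Fin 3 → ℂ) : Fin 3 → ℂ :=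
  -((r : ℂ)⁻¹ • (matQ C n *ᵥ U)) - matR C n *ᵥ V

lemma tractionAmp_eq (C : Tensor4) (n : ℕ) (r : ℝ) (U V : Fin 3 → ℂ) :
    tractionAmp C n r U V =
      ![c11 C * V 0 + (r : ℂ)⁻¹ * (2 * c12 C * U 0 - lam n * c12 C * U 1),
        c66 C * V 1 + (r : ℂ)⁻¹ * (lam n * c66 C * U 0 - c66 C * U 1),
        c66 C * V 2 - (r : ℂ)⁻¹ * (c66 C * U 2)] := by
  ext j
  fin_cases j <;>
    simp [tractionAmp, matT, matR, Matrix.mulVec, dotProduct, Fin.sum_univ_three,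
      -mul_eq_mul_left_iff] <;> ring

lemma tauAmp_eq (C : Tensor4) (n : ℕ) (r : ℝ) (U V : Fin 3 → ℂ) :
    tauAmp C n r U V =
      ![-(r : ℂ)⁻¹ * ((lam n ^ 2 * c66 C + 4 * (c22 C - c44 C)) * U 0
          + lam n * (2 * c44 C - 2 * c22 C - c66 C) * U 1)
          - (2 * c12 C * V 0 + lam n * c66 C * V 1),
        -(r : ℂ)⁻¹ * (lam n * (2 * c44 C - 2 * c22 C - c66 C) * U 0
          + (lam n ^ 2 * c22 C + c66 C - 2 * c44 C) * U 1)
          + (lam n * c12 C * V 0 + c66 C * V 1),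
        -(r : ℂ)⁻¹ * ((lam n ^ 2 * c44 C + c66 C - 2 * c44 C) * U 2) + c66 C * V 2] := by
  ext j
  fin_cases j
  all_goals simp [tauAmp, matQ, matR, dotProduct, Fin.sum_univ_three, -mul_eq_mul_left_iff]
  all_goals ring

lemma TIRelations.stress_radial {C : Tensor4} (H : TIRelations C) (hC : IsElastic C) (n : ℕ) (m : ℤ)
    (r : ℝ) (U V : Fin 3 → ℂ) (θ : ℝ) :
    stress C (latStrain n m r U V θ) 0 = latVec n m (tractionAmp C n r U V) θ := by
  have h := H.stress_eq hC (latStrain n m r U V θ) (strainForm_transpose _ _ _ _ _ _ _ _ _)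
  have h0 : ∀ j, stress C (latStrain n m r U V θ) 0 j = _ := fun j => congrFun₂ h 0 j
  funext j
  rw [h0, tractionAmp_eq]
  fin_cases j <;> simp [latVec, latStrain, strainForm] <;> ring

lemma TIRelations.tauForm_eq {C : Tensor4} (H : TIRelations C) (hC : IsElastic C) {n : ℕ} {m : ℤ}
    (hm : m.natAbs ≤ n) (r : ℝ) (U V : Fin 3 → ℂ) {θ : ℝ} (hθ : θ ∈ Set.Ioo 0 Real.pi) (j : Fin 3) :
    tauForm m θ (stress C (latStrain n m r U V θ) 1) (stress C (latStrain' n m r U V θ) 1)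
      (stress C (latStrain n m r U V θ) 2) j
      = Real.sin θ * latVec n m (tauAmp C n r U V) θ j := by
  have hs := sin_ne_zero_of_mem hθ
  have h := H.stress_eq hC (latStrain n m r U V θ) (strainForm_transpose _ _ _ _ _ _ _ _ _)
  have h' := H.stress_eq hC (latStrain' n m r U V θ) (strainForm_transpose _ _ _ _ _ _ _ _ _)
  have h1 : ∀ j, stress C (latStrain n m r U V θ) 1 j = _ := fun j => congrFun₂ h 1 j
  have h2 : ∀ j, stress C (latStrain n m r U V θ) 2 j = _ := fun j => congrFun₂ h 2 j
  have h1' : ∀ j, stress C (latStrain' n m r U V θ) 1 j = _ := fun j => congrFun₂ h' 1 j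
  have hI := Complex.I_sq
  have E0 : (m : ℂ) * latP n m θ = _ := (isProfile_lat hm).constraint θ hθ
  have E1 : Real.sin θ * latB' n m θ = m * latC n m θ - Real.cos θ * latB n m θ
      - lam n * Real.sin θ * latP n m θ := by
    rw [latB']
    field_simp
    ring
  have E2 : Real.sin θ * latC' n m θ = m * latB n m θ - Real.cos θ * latC n m θ := by
    rw [latC']
    field_simp
  have E3 : Real.sin θ * latB'' n m θ = m * latC' n m θ + Real.sin θ * latB n m θ
      - 2 * Real.cos θ * latB' n m θ - lam n * Real.cos θ * latP n m θ
      - lam n ^ 2 * Real.sin θ * latB n m θ := by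
    rw [latB'']
    field_simp
    ring
  have E4 : Real.sin θ * latC'' n m θ = m * latB' n m θ + Real.sin θ * latC n m θ
      - 2 * Real.cos θ * latC' n m θ := by
    rw [latC'']
    field_simp
    ring
  rw [tauAmp_eq]
  set f := latP n m θ
  set g := latB n m θ
  set k := latC n m θ
  set g₁ := latB' n m θ
  set k₁ := latC' n m θ
  set g₂ := latB'' n m θ
  set k₂ := latC'' n m θ
  fin_cases j
  · simp only [tauForm, latVec, h1, h1', h2, Fin.zero_eta, Fin.isValue, Matrix.of_apply, Matrix.cons_val]
    simp only [latStrain, latStrain', strainForm, Fin.isValue, Matrix.of_apply, Matrix.cons_val]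
    linear_combination (c66 C * (V 1 + (r : ℂ)⁻¹ * (lam n * U 0 - U 1))) * E1
      + (Complex.I * c66 C * (V 2 - (r : ℂ)⁻¹ * U 2)) * E2
      + (m * c66 C * (V 1 + (r : ℂ)⁻¹ * (lam n * U 0 - U 1)) * k) * hI
  · simp only [tauForm, latVec, h1, h1', h2, Fin.mk_one, Fin.isValue, Matrix.of_apply, Matrix.cons_val]
    simp only [latStrain, latStrain', strainForm, Fin.isValue, Matrix.of_apply, Matrix.cons_val]
    linear_combination (2 * c44 C * (r : ℂ)⁻¹ * U 1) * E3
      + (2 * c44 C * (r : ℂ)⁻¹ * Complex.I * U 2) * E4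
      + (2 * c44 C * (r : ℂ)⁻¹ * m * U 1 * k₁) * hI
      - (Complex.I * (r : ℂ)⁻¹ * c44 C * lam n * U 2) * E0
  · simp only [tauForm, latVec, h1, h1', h2, Fin.reduceFinMk, Fin.isValue, Matrix.of_apply, Matrix.cons_val]
    simp only [latStrain, latStrain', strainForm, Fin.isValue, Matrix.of_apply, Matrix.cons_val]
    linear_combination (2 * c44 C * (r : ℂ)⁻¹ * Complex.I * U 1) * E4
      - (2 * c44 C * (r : ℂ)⁻¹ * U 2) * E3
      - (2 * c44 C * (r : ℂ)⁻¹ * m * U 2 * k₁) * hI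
      + (Complex.I * (c12 C * V 0 + (r : ℂ)⁻¹ * ((2 * c22 C - 2 * c44 C) * U 0
        - lam n * c22 C * U 1))) * E0

/-! ### Recovering amplitudes from point values -/

/-- The amplitudes are fixed linear combinations of finitely many values of the field `∑_A a_A A`.
Since `B` and `C` may be linearly dependent at a point (`g = ±h`), the combinations `a_B ∓ i a_C`
are read off separately, at points where `g - h` and `g + h` do not vanish. -/
lemma exists_amplitude_functionals {n : ℕ} {m : ℤ} (hm : m.natAbs ≤ n) (hn : n ≠ 0) :
    ∃ θ₀ ∈ Set.Ioo 0 Real.pi, ∃ θ₁ ∈ Set.Ioo 0 Real.pi, ∃ θ₂ ∈ Set.Ioo 0 Real.pi,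
      ∃ α β γ : ℂ, ∀ a : Fin 3 → ℂ,
        a 0 = α * synth n m a θ₀ 0 0 ∧
        a 1 = β * (synth n m a θ₁ 0 1 + Complex.I * synth n m a θ₁ 0 2)
          + γ * (synth n m a θ₂ 0 1 - Complex.I * synth n m a θ₂ 0 2) ∧
        a 2 = Complex.I * β * (synth n m a θ₁ 0 1 + Complex.I * synth n m a θ₁ 0 2)
          - Complex.I * γ * (synth n m a θ₂ 0 1 - Complex.I * synth n m a θ₂ 0 2) := by
  have hf := exists_latP_ne_zero hm
  obtain ⟨θ₁, hθ₁, h1⟩ := (isProfile_lat hm).exists_sub_ne_zero (lam_ne_zero hn) hf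
  obtain ⟨θ₂, hθ₂, h2⟩ := (isProfile_lat hm).exists_add_ne_zero (lam_ne_zero hn) hf
  obtain ⟨θ₀, hθ₀, h0⟩ := hf
  refine ⟨θ₀, hθ₀, θ₁, hθ₁, θ₂, hθ₂, (latP n m θ₀)⁻¹, (latB n m θ₁ - latC n m θ₁)⁻¹ / 2,
    (latB n m θ₂ + latC n m θ₂)⁻¹ / 2, fun a => ?_⟩
  have hI := Complex.I_sq
  have e1 : synth n m a θ₁ 0 1 + Complex.I * synth n m a θ₁ 0 2
      = (a 1 - Complex.I * a 2) * (latB n m θ₁ - latC n m θ₁) := by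
    simp only [synth_eq, azim_zero_right, latVec, Matrix.cons_val]
    linear_combination (a 1 * latC n m θ₁) * hI
  have e2 : synth n m a θ₂ 0 1 - Complex.I * synth n m a θ₂ 0 2
      = (a 1 + Complex.I * a 2) * (latB n m θ₂ + latC n m θ₂) := by
    simp only [synth_eq, azim_zero_right, latVec, Matrix.cons_val]
    linear_combination -(a 1 * latC n m θ₂) * hI
  rw [e1, e2]
  refine ⟨?_, ?_, ?_⟩
  · simp only [synth_eq, azim_zero_right, latVec, Matrix.cons_val]
    field_simp
  · field_simp
    ring
  · field_simp
    linear_combination 2 * a 2 * hI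

lemma synth_degree_zero (a : Fin 3 → ℂ) (θ φ : ℝ) :
    synth 0 0 a θ φ = synth 0 0 ![a 0, 0, 0] θ φ := by
  ext j
  rw [synth_eq, synth_eq]
  fin_cases j <;> simp [latVec, latB, latC, lam_zero]

/-- A family of fields `∑_A W_A(s) A` whose point values are differentiable in `s` has
differentiable amplitudes. For `n = 0` nothing is learnt about the amplitudes of the vanishing
`B` and `C`, hence the extra hypothesis. -/
lemma differentiableAt_amplitudes {n : ℕ} {m : ℤ} (hm : m.natAbs ≤ n)
    {W : ℝ → Fin 3 → ℂ} {r : ℝ} (h0 : n = 0 → ∀ᶠ s in nhds r, W s 1 = 0 ∧ W s 2 = 0)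
    (h : ∀ θ ∈ Set.Ioo 0 Real.pi, ∀ φ j, DifferentiableAt ℝ (fun s => synth n m (W s) θ φ j) r) :
    DifferentiableAt ℝ W r := by
  refine differentiableAt_pi.2 fun i => ?_
  rcases eq_or_ne n 0 with hn | hn
  · have h0 := h0 hn
    obtain ⟨θ, hθ, hf⟩ := exists_latP_ne_zero hm
    fin_cases i
    · refine ((h θ hθ 0 0).const_mul (latP n m θ)⁻¹).congr_of_eventuallyEq (.of_forall fun s => ?_)
      simp only [synth_eq, azim_zero_right, latVec, Matrix.cons_val]
      field_simp
      rfl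
    · exact (differentiableAt_const (0 : ℂ)).congr_of_eventuallyEq (h0.mono fun s hs => hs.1)
    · exact (differentiableAt_const (0 : ℂ)).congr_of_eventuallyEq (h0.mono fun s hs => hs.2)
  · obtain ⟨θ₀, hθ₀, θ₁, hθ₁, θ₂, hθ₂, α, β, γ, key⟩ := exists_amplitude_functionals hm hn
    have d0 := h θ₀ hθ₀ 0
    have d1 := h θ₁ hθ₁ 0
    have d2 := h θ₂ hθ₂ 0
    have h1 := (d1 1).fun_add ((d1 2).const_mul Complex.I)
    have h2 := (d2 1).fun_sub ((d2 2).const_mul Complex.I)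
    fin_cases i
    · exact ((d0 0).const_mul α).congr_of_eventuallyEq (.of_forall fun s => (key (W s)).1)
    · exact ((h1.const_mul β).fun_add (h2.const_mul γ)).congr_of_eventuallyEq
        (.of_forall fun s => (key (W s)).2.1)
    · exact ((h1.const_mul (Complex.I * β)).fun_sub (h2.const_mul (Complex.I * γ))
        ).congr_of_eventuallyEq (.of_forall fun s => (key (W s)).2.2)

lemma eq_of_synth_eq {n : ℕ} {m : ℤ} (hm : m.natAbs ≤ n) {a b : Fin 3 → ℂ}
    (h0 : n = 0 → (a 1 = 0 ∧ a 2 = 0) ∧ b 1 = 0 ∧ b 2 = 0)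
    (h : ∀ θ ∈ Set.Ioo 0 Real.pi, ∀ φ j, synth n m a θ φ j = synth n m b θ φ j) : a = b := by
  have h : ∀ θ ∈ Set.Ioo 0 Real.pi, ∀ φ, synth n m a θ φ = synth n m b θ φ :=
    fun θ hθ φ => funext (h θ hθ φ)
  rcases eq_or_ne n 0 with hn | hn
  · obtain ⟨⟨a1, a2⟩, b1, b2⟩ := h0 hn
    obtain ⟨θ, hθ, hf⟩ := exists_latP_ne_zero hm
    have h1 := congrFun (h θ hθ 0) 0
    simp only [synth_eq, azim_zero_right, latVec, Matrix.cons_val, one_mul] at h1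
    ext i
    fin_cases i
    · exact mul_right_cancel₀ hf h1
    · exact a1.trans b1.symm
    · exact a2.trans b2.symm
  · obtain ⟨θ₀, hθ₀, θ₁, hθ₁, θ₂, hθ₂, α, β, γ, key⟩ := exists_amplitude_functionals hm hn
    ext i
    fin_cases i
    · exact (key a).1.trans ((by rw [h θ₀ hθ₀] : _ = _).trans (key b).1.symm)
    · exact (key a).2.1.trans ((by rw [h θ₁ hθ₁, h θ₂ hθ₂] : _ = _).trans (key b).2.1.symm)
    · exact (key a).2.2.trans ((by rw [h θ₁ hθ₁, h θ₂ hθ₂] : _ = _).trans (key b).2.2.symm)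

/-! ### Necessity of transverse isotropy -/

/-- At the radius `r`, amplitudes with values `U` and derivatives `V` produce `t_r` and `τ` that
are again combinations of `P`, `B`, `C`. -/
def SeparatesAt (C : Tensor4) (n : ℕ) (m : ℤ) (r : ℝ) (U V : Fin 3 → ℂ) : Prop :=
  (∃ T : Fin 3 → ℂ, ∀ θ ∈ Set.Ioo 0 Real.pi,
    stress C (latStrain n m r U V θ) 0 = latVec n m T θ) ∧
  ∃ Γ : Fin 3 → ℂ, ∀ θ ∈ Set.Ioo 0 Real.pi, ∀ j,
    tauForm m θ (stress C (latStrain n m r U V θ) 1) (stress C (latStrain' n m r U V θ) 1)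
      (stress C (latStrain n m r U V θ) 2) j = Real.sin θ * latVec n m Γ θ j

lemma exists_latP_zero_zero : ∃ p : ℂ, p ≠ 0 ∧ ∀ θ ∈ Set.Ioo 0 Real.pi, latP 0 0 θ = p := by
  refine ⟨(harmonicNorm 0 0 : ℂ), by exact_mod_cast harmonicNorm_ne_zero 0 0, fun θ hθ => ?_⟩
  rw [latP_eq 0 0 hθ]
  simp

open Polynomial in
lemma iterate_derivative_four_sq_sub_one_sq :
    derivative^[4] ((X ^ 2 - 1 : ℝ[X]) ^ 2) = C 24 := by
  have h1 : (X ^ 2 - 1 : ℝ[X]) ^ 2 = X ^ 4 - C 2 * X ^ 2 + C 1 := by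
    rw [map_ofNat, map_one]
    ring
  have h : ∀ p : ℝ[X], derivative^[4] p = derivative (derivative (derivative (derivative p))) :=
    fun _ => rfl
  rw [h1, h]
  simp only [derivative_add, derivative_sub, derivative_C_mul, derivative_X_pow, derivative_C,
    Nat.cast_ofNat, Nat.add_one_sub_one, pow_one, derivative_X, mul_one, add_zero, sub_zero, ← C_mul]
  norm_num

/-- The sectoral harmonic of degree and order two, in units of a constant `κ`. -/
lemma exists_lat_two_two : ∃ κ : ℂ, κ ≠ 0 ∧ ∀ θ ∈ Set.Ioo 0 Real.pi,
    lam 2 * latP 2 2 θ = 3 * κ * Real.sin θ ^ 2 ∧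
    latB 2 2 θ = κ * (Real.sin θ * Real.cos θ) ∧ latC 2 2 θ = κ * Real.sin θ := by
  have hl := lam_ne_zero (n := 2) two_ne_zero
  have hl2 : (lam 2 : ℂ) ^ 2 = 6 := by
    rw [lam_sq]
    norm_num
  have hN : (harmonicNorm 2 2 : ℂ) ≠ 0 := by exact_mod_cast harmonicNorm_ne_zero 2 2
  have hP : ∀ θ ∈ Set.Ioo 0 Real.pi,
      latP 2 2 θ = 3 * (harmonicNorm 2 2 : ℂ) * (Real.sin θ : ℂ) ^ 2 := by
    intro θ hθ
    rw [latP_eq 2 2 hθ, show (((2 : ℕ) : ℤ) + 2).toNat = 4 from rfl,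
      iterate_derivative_four_sq_sub_one_sq, Polynomial.eval_C]
    norm_num [Nat.factorial]
    ring
  refine ⟨6 * harmonicNorm 2 2 / lam 2, by simp [hl, hN], fun θ hθ => ⟨?_, ?_, ?_⟩⟩
  · rw [hP θ hθ]
    field_simp
    linear_combination (Real.sin θ : ℂ) ^ 2 * hl2
  · have h1 := hasDerivAt_latP (n := 2) (m := 2) (by decide) hθ
    have h2 := (((hasDerivAt_ofReal_sin θ).pow 2).const_mul
      (3 * (harmonicNorm 2 2 : ℂ))).congr_of_eventuallyEq
      (f₁ := latP 2 2) (by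
        filter_upwards [isOpen_Ioo.mem_nhds hθ] with t ht using hP t ht)
    have h3 := h1.unique h2
    field_simp
    simp only [Nat.cast_ofNat, Nat.add_one_sub_one, pow_one] at h3
    linear_combination h3
  · have hs := sin_ne_zero_of_mem hθ
    rw [latC, hP θ hθ]
    push_cast
    field_simp
    ring

lemma exists_angle {s c : ℝ} (hs : 0 < s) (h : s ^ 2 + c ^ 2 = 1) :
    ∃ θ ∈ Set.Ioo 0 Real.pi, Real.sin θ = s ∧ Real.cos θ = c := by
  have h1 : -1 < c := by nlinarith
  have h2 : c < 1 := by nlinarith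
  refine ⟨Real.arccos c, ⟨Real.arccos_pos.2 h2, Real.arccos_lt_pi.2 h1⟩, ?_,
    Real.cos_arccos h1.le h2.le⟩
  rw [Real.sin_arccos, ← h, add_sub_cancel_right, Real.sqrt_sq hs.le]

/-- Instances of a statement about `(sin θ, cos θ)` at four angles with rational sine and cosine;
they suffice for all the comparisons of coefficients below. -/
lemma forall_angles {P : ℂ → ℂ → Prop}
    (h : ∀ θ ∈ Set.Ioo 0 Real.pi, P (Real.sin θ) (Real.cos θ)) :
    P 1 0 ∧ P (4 / 5) (3 / 5) ∧ P (4 / 5) (-(3 / 5)) ∧ P (3 / 5) (4 / 5) := by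
  have key : ∀ s c : ℝ, 0 < s → s ^ 2 + c ^ 2 = 1 → P s c := by
    intro s c hs hsc
    obtain ⟨θ, hθ, h1, h2⟩ := exists_angle hs hsc
    simpa [h1, h2, -Complex.ofReal_sin, -Complex.ofReal_cos] using h θ hθ
  refine ⟨?_, ?_, ?_, ?_⟩
  · simpa using key 1 0 (by norm_num) (by norm_num)
  · simpa using key (4 / 5) (3 / 5) (by norm_num) (by norm_num)
  · simpa using key (4 / 5) (-(3 / 5)) (by norm_num) (by norm_num)
  · simpa using key (3 / 5) (4 / 5) (by norm_num) (by norm_num)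

lemma stress_smul (C : Tensor4) (a : ℂ) (S : Matrix (Fin 3) (Fin 3) ℂ) (i j : Fin 3) :
    stress C (a • S) i j = a * stress C S i j := by
  simp only [stress, Finset.mul_sum, Matrix.smul_apply, smul_eq_mul, mul_left_comm]

/-- The relations forced by the spherically symmetric displacements (`n = 0`): tractions along the
tangential frame vectors must vanish, as must the terms of `τ` in `cot θ`. -/
lemma relations_of_separatesAt_zero {C : Tensor4} (hC : IsElastic C) {r : ℝ} (hr : r ≠ 0)
    (h : ∀ U V, SeparatesAt C 0 0 r U V) :
    (∀ j, j ≠ 0 → C 0 j 0 0 = 0 ∧ C 0 j 1 1 + C 0 j 2 2 = 0) ∧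
    (C 1 1 0 0 = C 2 2 0 0 ∧ C 1 2 0 0 = 0) ∧
    (C 1 1 1 1 + C 1 1 2 2 = C 2 2 1 1 + C 2 2 2 2 ∧ C 1 2 1 1 + C 1 2 2 2 = 0) := by
  obtain ⟨p, hp, hP⟩ := exists_latP_zero_zero
  have hrC : (r : ℂ) ≠ 0 := by exact_mod_cast hr
  have hB : ∀ θ, latB 0 0 θ = 0 := fun θ => by simp [latB, lam_zero]
  have hK : ∀ θ, latC 0 0 θ = 0 := fun θ => by simp [latC, lam_zero]
  have hB' : ∀ θ, latB' 0 0 θ = 0 := fun θ => by simp [latB', hB, lam_zero]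
  have hK' : ∀ θ, latC' 0 0 θ = 0 := fun θ => by simp [latC', hB, hK]
  have hB'' : ∀ θ, latB'' 0 0 θ = 0 := fun θ => by simp [latB'', hB, hB', lam_zero]
  have hK'' : ∀ θ, latC'' 0 0 θ = 0 := fun θ => by simp [latC'', hK, hK']
  have hS : ∀ θ ∈ Set.Ioo 0 Real.pi, ∀ u v : ℂ,
      latStrain 0 0 r ![u, 0, 0] ![v, 0, 0] θ
        = p • Matrix.diagonal ![v, (r : ℂ)⁻¹ * u, (r : ℂ)⁻¹ * u] := by
    intro θ hθ u v
    ext i j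
    fin_cases i <;> fin_cases j <;>
      simp [latStrain, strainForm, hP θ hθ, hB, hK, hB', hK', lam_zero] <;> ring
  have hS' : ∀ θ, ∀ u v : ℂ, latStrain' 0 0 r ![u, 0, 0] ![v, 0, 0] θ = 0 := by
    intro θ u v
    ext i j
    fin_cases i <;> fin_cases j <;>
      simp [latStrain', strainForm, hB, hB', hK', hB'', hK'', lam_zero]
  have key : ∀ u v : ℂ, (∀ j, j ≠ 0 → C 0 j 0 0 * v + (C 0 j 1 1 + C 0 j 2 2) * u = 0) ∧
      (C 1 1 0 0 * v + (C 1 1 1 1 + C 1 1 2 2) * u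
        = C 2 2 0 0 * v + (C 2 2 1 1 + C 2 2 2 2) * u) ∧
      C 1 2 0 0 * v + (C 1 2 1 1 + C 1 2 2 2) * u = 0 := by
    intro u v
    obtain ⟨⟨T, hT⟩, Γ, hΓ⟩ := h ![r * u, 0, 0] ![v, 0, 0]
    have hst : ∀ θ ∈ Set.Ioo 0 Real.pi, ∀ i j,
        stress C (latStrain 0 0 r ![r * u, 0, 0] ![v, 0, 0] θ) i j
          = p * (C i j 0 0 * v + (C i j 1 1 + C i j 2 2) * u) := by
      intro θ hθ i j
      rw [hS θ hθ, stress_smul, inv_mul_cancel_left₀ hrC]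
      congr 1
      simp [stress, Fin.sum_univ_three]
      ring
    have ht : ∀ j, j ≠ 0 → C 0 j 0 0 * v + (C 0 j 1 1 + C 0 j 2 2) * u = 0 := by
      intro j hj
      have hθ : Real.pi / 2 ∈ Set.Ioo 0 Real.pi := ⟨by positivity, by linarith [Real.pi_pos]⟩
      have h1 := congrFun (hT _ hθ) j
      rw [hst _ hθ] at h1
      have h2 : latVec 0 0 T (Real.pi / 2) j = 0 := by
        fin_cases j
        · exact absurd rfl hj
        · simp [latVec, hB, hK]
        · simp [latVec, hB, hK]
      exact (mul_eq_zero.1 (h1.trans h2)).resolve_left hp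
    have hcon : ∀ i, ∀ j, j ≠ 0 → i = 0 → C j i 0 0 * v + (C j i 1 1 + C j i 2 2) * u = 0 := by
      rintro i j hj rfl
      simpa only [hC.minor_left j 0] using ht j hj
    have h10 := hcon 0 1 (by decide) rfl
    have h20 := hcon 0 2 (by decide) rfl
    obtain ⟨θ, hθ, hsin, hcos⟩ := exists_angle (s := 4 / 5) (c := 3 / 5) (by norm_num) (by norm_num)
    have e1 := hΓ θ hθ 1
    have e2 := hΓ θ hθ 2
    simp only [tauForm, latVec, hB, hK, hS', hst θ hθ, hsin, hcos, Matrix.cons_val, h10,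
      h20] at e1 e2
    simp [stress] at e1 e2
    refine ⟨ht, ?_, ?_⟩
    · refine mul_left_cancel₀ hp ?_
      linear_combination (5 / 3) * e1
    · refine (mul_eq_zero.1 (?_ : p * _ = 0)).resolve_left hp
      have := hC.minor_left 2 1
      rw [this, this, this] at e2
      linear_combination (5 / 6) * e2
  have k1 := key 0 1
  have k2 := key 1 0
  simp only [mul_one, mul_zero, zero_add, add_zero] at k1 k2
  exact ⟨fun j hj => ⟨k1.1 j hj, k2.1 j hj⟩, k1.2, k2.2⟩

/-- The tangential components of `t_r` for the harmonic of degree and order two lead to this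
trigonometric identity, which has only the zero solution. -/
lemma eq_zero_of_angles {X Y A B : ℂ}
    (h : ∀ θ ∈ Set.Ioo 0 Real.pi, X * (1 + (Real.cos θ : ℂ) ^ 2) + 2 * Complex.I * Y * Real.cos θ
      = Real.sin θ * (A * Real.cos θ + B * Complex.I)) : X = 0 ∧ Y = 0 := by
  obtain ⟨h1, h2, h3, h4⟩ := forall_angles
    (P := fun s c => X * (1 + c ^ 2) + 2 * Complex.I * Y * c = s * (A * c + B * Complex.I)) h
  have hX : X = 0 := by linear_combination (25 / 14) * ((h2 + h3) / 2 - (4 / 5) * h1)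
  refine ⟨hX, (mul_eq_zero.1 (?_ : Complex.I * Y = 0)).resolve_left Complex.I_ne_zero⟩
  linear_combination (5 / 2) * (h4 - (h2 - h3) / 2 - (3 / 5) * h1 - (26 / 25) * hX)

/-- The amplitude `U_B = r` turns off the strain components with an index `r`. -/
lemma strainForm_deviatoric {r : ℝ} (hr : r ≠ 0) (l f g h g₁ h₁ : ℂ) :
    strainForm l r ![0, r, 0] ![0, 1, 0] f g h g₁ h₁
      = !![0, 0, 0; 0, g₁, Complex.I * h₁; 0, Complex.I * h₁, -(l * f + g₁)] := by
  have hrC : (r : ℂ) ≠ 0 := by exact_mod_cast hr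
  ext i j
  fin_cases i <;> fin_cases j <;> simp [strainForm, hrC] <;> field_simp

/-- Separation in the harmonics `(0, 0)` and `(2, 2)` at one radius forces transverse isotropy there.
Degree two is the least one with a nonzero deviatoric tangential strain, which is needed to see the
relation `c_{1122} = c_{1111} - 2 c_{1212}` and its companions. -/
lemma TIRelations.of_separatesAt {C : Tensor4} (hC : IsElastic C) {r : ℝ} (hr : r ≠ 0)
    (h : ∀ (n : ℕ) (m : ℤ), m.natAbs ≤ n → ∀ U V, SeparatesAt C n m r U V) : TIRelations C := by
  have hrC : (r : ℂ) ≠ 0 := by exact_mod_cast hr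
  obtain ⟨z1, ⟨z2, z3⟩, z4, z5⟩ := relations_of_separatesAt_zero hC hr (h 0 0 (by decide))
  obtain ⟨κ, hκ, hlat⟩ := exists_lat_two_two
  have hm : (2 : ℤ).natAbs ≤ 2 := by decide
  have hl2 : (lam 2 : ℂ) ^ 2 = 6 := by
    rw [lam_sq]
    norm_num
  have hB' : ∀ θ ∈ Set.Ioo 0 Real.pi,
      latB' 2 2 θ = κ * ((Real.cos θ : ℂ) ^ 2 - (Real.sin θ : ℂ) ^ 2) := by
    intro θ hθ
    have hs := sin_ne_zero_of_mem hθ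
    obtain ⟨h1, h2, h3⟩ := hlat θ hθ
    rw [latB', h1, h2, h3]
    push_cast [-Complex.ofReal_sin, -Complex.ofReal_cos]
    field_simp
    linear_combination -2 * sin_sq_add_cos_sq_ofReal θ
  have hK' : ∀ θ ∈ Set.Ioo 0 Real.pi, latC' 2 2 θ = κ * Real.cos θ := by
    intro θ hθ
    have hs := sin_ne_zero_of_mem hθ
    obtain ⟨h1, h2, h3⟩ := hlat θ hθ
    rw [latC', h2, h3]
    push_cast [-Complex.ofReal_sin, -Complex.ofReal_cos]
    field_simp
    ring
  have hB'' : ∀ θ ∈ Set.Ioo 0 Real.pi, latB'' 2 2 θ = -4 * κ * (Real.sin θ * Real.cos θ) := by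
    intro θ hθ
    have hs := sin_ne_zero_of_mem hθ
    obtain ⟨h1, h2, h3⟩ := hlat θ hθ
    rw [latB'', hK' θ hθ, hB' θ hθ, mul_right_comm (lam 2 : ℂ), h1, h2, hl2]
    push_cast [-Complex.ofReal_sin, -Complex.ofReal_cos]
    field_simp
    linear_combination -2 * (Real.cos θ : ℂ) * sin_sq_add_cos_sq_ofReal θ
  have hK'' : ∀ θ ∈ Set.Ioo 0 Real.pi, latC'' 2 2 θ = -κ * Real.sin θ := by
    intro θ hθ
    have hs := sin_ne_zero_of_mem hθ
    obtain ⟨h1, h2, h3⟩ := hlat θ hθ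
    rw [latC'', hK' θ hθ, hB' θ hθ, h3]
    push_cast [-Complex.ofReal_sin, -Complex.ofReal_cos]
    field_simp
    ring
  have hvec : ∀ T : Fin 3 → ℂ, ∀ θ ∈ Set.Ioo 0 Real.pi,
      latVec 2 2 T θ 1 = κ * (Real.sin θ * (T 1 * Real.cos θ + T 2 * Complex.I)) ∧
      latVec 2 2 T θ 2 = κ * (Real.sin θ * (-T 2 * Real.cos θ + T 1 * Complex.I)) := by
    intro T θ hθ
    obtain ⟨h1, h2, h3⟩ := hlat θ hθ
    constructor <;> simp only [latVec, h2, h3, Matrix.cons_val] <;> ring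
  -- A pure radial gradient of the `B`-amplitude tests the shear moduli `C 0 i 0 j`.
  have shear : C 0 1 0 2 = 0 ∧ C 0 2 0 2 = C 0 1 0 1 := by
    obtain ⟨⟨T, hT⟩, -⟩ := h 2 2 hm 0 ![0, 1, 0]
    have hS : ∀ θ ∈ Set.Ioo 0 Real.pi, latStrain 2 2 r 0 ![0, 1, 0] θ
        = (κ * Real.sin θ / 2) • !![0, (Real.cos θ : ℂ), Complex.I; (Real.cos θ : ℂ), 0, 0;
          Complex.I, 0, 0] := by
      intro θ hθ
      obtain ⟨h1, h2, h3⟩ := hlat θ hθ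
      ext i j
      fin_cases i <;> fin_cases j <;> simp [latStrain, strainForm, h2, h3] <;> ring
    have hst : ∀ θ ∈ Set.Ioo 0 Real.pi, ∀ j, stress C (latStrain 2 2 r 0 ![0, 1, 0] θ) 0 j
        = κ * (Real.sin θ * (C 0 j 0 1 * Real.cos θ + C 0 j 0 2 * Complex.I)) := by
      intro θ hθ j
      rw [hS θ hθ, stress_smul]
      simp [stress, Fin.sum_univ_three, hC.minor_right 0 j 1 0, hC.minor_right 0 j 2 0]
      ring
    have hcancel : ∀ {θ : ℝ}, θ ∈ Set.Ioo 0 Real.pi → ∀ {a b : ℂ},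
        κ * (Real.sin θ * a) = κ * (Real.sin θ * b) → a = b := fun hθ _ _ hab =>
      mul_left_cancel₀ (sin_ne_zero_of_mem hθ) (mul_left_cancel₀ hκ hab)
    have e : ∀ θ ∈ Set.Ioo 0 Real.pi,
        C 0 1 0 1 * (Real.cos θ : ℂ) + C 0 1 0 2 * Complex.I = T 1 * Real.cos θ + T 2 * Complex.I ∧
        C 0 2 0 1 * (Real.cos θ : ℂ) + C 0 2 0 2 * Complex.I
          = -T 2 * Real.cos θ + T 1 * Complex.I := by
      intro θ hθ
      have e1 := congrFun (hT θ hθ) 1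
      have e2 := congrFun (hT θ hθ) 2
      rw [hst θ hθ, (hvec T θ hθ).1] at e1
      rw [hst θ hθ, (hvec T θ hθ).2] at e2
      exact ⟨hcancel hθ e1, hcancel hθ e2⟩
    obtain ⟨a1, a2, -, -⟩ := forall_angles (P := fun _ c =>
      C 0 1 0 1 * c + C 0 1 0 2 * Complex.I = T 1 * c + T 2 * Complex.I ∧
      C 0 2 0 1 * c + C 0 2 0 2 * Complex.I = -T 2 * c + T 1 * Complex.I) e
    have b1 : C 0 1 0 2 = T 2 := mul_right_cancel₀ Complex.I_ne_zero (by linear_combination a1.1)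
    have b2 : C 0 2 0 2 = T 1 := mul_right_cancel₀ Complex.I_ne_zero (by linear_combination a1.2)
    have b3 : C 0 1 0 1 = T 1 := by linear_combination (5 / 3) * (a2.1 - a1.1)
    have b4 : C 0 2 0 1 = -T 2 := by linear_combination (5 / 3) * (a2.2 - a1.2)
    have b5 := hC.major 0 1 0 2
    exact ⟨by linear_combination (1 / 2) * (b1 + b4 + b5), b2.trans b3.symm⟩
  -- The amplitude `U_B = r` leaves only a tangential strain, with a nonzero deviatoric part.
  obtain ⟨⟨T, hT⟩, Γ, hΓ⟩ := h 2 2 hm ![0, r, 0] ![0, 1, 0]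
  have hS : ∀ θ ∈ Set.Ioo 0 Real.pi, latStrain 2 2 r ![0, r, 0] ![0, 1, 0] θ
      = κ • !![0, 0, 0;
        0, (Real.cos θ : ℂ) ^ 2 - (Real.sin θ : ℂ) ^ 2, Complex.I * Real.cos θ;
        0, Complex.I * Real.cos θ, -((Real.cos θ : ℂ) ^ 2 + 2 * (Real.sin θ : ℂ) ^ 2)] := by
    intro θ hθ
    rw [latStrain, strainForm_deviatoric hr, (hlat θ hθ).1, hB' θ hθ, hK' θ hθ]
    ext i j
    fin_cases i <;> fin_cases j <;> simp [-Complex.ofReal_sin, -Complex.ofReal_cos] <;> ring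
  have hS' : ∀ θ ∈ Set.Ioo 0 Real.pi, latStrain' 2 2 r ![0, r, 0] ![0, 1, 0] θ
      = (-κ * Real.sin θ) • !![0, 0, 0;
        0, 4 * (Real.cos θ : ℂ), Complex.I;
        0, Complex.I, 2 * (Real.cos θ : ℂ)] := by
    intro θ hθ
    have h6 : (lam 2 : ℂ) * (lam 2 * latB 2 2 θ) = 6 * κ * (Real.sin θ * Real.cos θ) := by
      rw [(hlat θ hθ).2.1]
      linear_combination κ * Real.sin θ * Real.cos θ * hl2
    rw [latStrain', strainForm_deviatoric hr, h6, hB'' θ hθ, hK'' θ hθ]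
    ext i j
    fin_cases i <;> fin_cases j <;> simp [-Complex.ofReal_sin, -Complex.ofReal_cos] <;> ring
  have hst : ∀ θ ∈ Set.Ioo 0 Real.pi, ∀ i j,
      stress C (latStrain 2 2 r ![0, r, 0] ![0, 1, 0] θ) i j
      = κ * (C i j 1 1 * ((Real.cos θ : ℂ) ^ 2 - (Real.sin θ : ℂ) ^ 2)
        + 2 * Complex.I * C i j 1 2 * Real.cos θ
        - C i j 2 2 * ((Real.cos θ : ℂ) ^ 2 + 2 * (Real.sin θ : ℂ) ^ 2)) := by
    intro θ hθ i j
    rw [hS θ hθ, stress_smul]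
    simp [stress, Fin.sum_univ_three, hC.minor_right i j 2 1, -mul_eq_mul_left_iff]
    ring
  have hst' : ∀ θ ∈ Set.Ioo 0 Real.pi, ∀ i j,
      stress C (latStrain' 2 2 r ![0, r, 0] ![0, 1, 0] θ) i j
      = -κ * Real.sin θ * (4 * C i j 1 1 * (Real.cos θ : ℂ) + 2 * Complex.I * C i j 1 2
        + 2 * C i j 2 2 * Real.cos θ) := by
    intro θ hθ i j
    rw [hS' θ hθ, stress_smul]
    simp [stress, Fin.sum_univ_three, hC.minor_right i j 2 1, -mul_eq_mul_left_iff]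
    ring
  have y1 : C 0 1 1 1 = 0 ∧ C 0 1 1 2 = 0 := by
    refine eq_zero_of_angles (A := T 1) (B := T 2) fun θ hθ => ?_
    have e := congrFun (hT θ hθ) 1
    rw [hst θ hθ, (hvec T θ hθ).1] at e
    have hz : C 0 1 2 2 = -C 0 1 1 1 := by linear_combination (z1 1 (by decide)).2
    linear_combination mul_left_cancel₀ hκ e
      + ((Real.cos θ : ℂ) ^ 2 + 2 * (Real.sin θ : ℂ) ^ 2) * hz
      - C 0 1 1 1 * sin_sq_add_cos_sq_ofReal θ
  have y2 : C 0 2 1 1 = 0 ∧ C 0 2 1 2 = 0 := by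
    refine eq_zero_of_angles (A := -T 2) (B := T 1) fun θ hθ => ?_
    have e := congrFun (hT θ hθ) 2
    rw [hst θ hθ, (hvec T θ hθ).2] at e
    have hz : C 0 2 2 2 = -C 0 2 1 1 := by linear_combination (z1 2 (by decide)).2
    linear_combination mul_left_cancel₀ hκ e
      + ((Real.cos θ : ℂ) ^ 2 + 2 * (Real.sin θ : ℂ) ^ 2) * hz
      - C 0 2 1 1 * sin_sq_add_cos_sq_ofReal θ
  have y3 : C 0 1 2 2 = 0 := by linear_combination (z1 1 (by decide)).2 - y1.1
  have y4 : C 0 2 2 2 = 0 := by linear_combination (z1 2 (by decide)).2 - y2.1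
  have w2 : C 2 2 1 1 = C 1 1 2 2 := hC.major _ _ _ _
  have w1 : C 2 2 2 2 = C 1 1 1 1 := by linear_combination -z4 - w2
  have w3 : C 2 2 1 2 = C 1 2 2 2 := hC.major _ _ _ _
  have w4 : C 1 2 1 1 = C 1 1 1 2 := hC.major _ _ _ _
  have w5 : C 1 2 2 2 = -C 1 1 1 2 := by linear_combination z5 - w4
  have hτ : ∀ θ ∈ Set.Ioo 0 Real.pi,
      -4 * (Real.sin θ : ℂ) ^ 2 * Real.cos θ * C 1 1 1 1
        - 2 * (Real.sin θ : ℂ) ^ 2 * Real.cos θ * C 1 1 2 2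
        + Real.cos θ * (1 + (Real.cos θ : ℂ) ^ 2) * (C 1 1 1 1 - C 1 1 2 2)
        - 4 * C 1 2 1 2 * Real.cos θ + 8 * Complex.I * C 1 1 1 2 * (Real.cos θ : ℂ) ^ 2
      = (Real.sin θ : ℂ) ^ 2 * (Γ 1 * Real.cos θ + Γ 2 * Complex.I) := by
    intro θ hθ
    have e := hΓ θ hθ 1
    simp only [tauForm, Matrix.cons_val] at e
    rw [(hvec Γ θ hθ).1, hst' θ hθ, hst θ hθ, hst θ hθ, hst θ hθ, hst θ hθ] at e
    rw [hC.minor_left 1 0, hC.minor_left 1 0, hC.minor_left 1 0, hC.minor_left 2 1,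
      hC.minor_left 2 1, hC.minor_left 2 1, y1.1, y1.2, y3, w1, w2, w3, w4, w5] at e
    have hI := Complex.I_sq
    have hsc := sin_sq_add_cos_sq_ofReal θ
    refine mul_left_cancel₀ hκ ?_
    linear_combination e - κ * Real.cos θ * (C 1 1 1 1 - C 1 1 2 2) * hsc
      - 4 * κ * Real.cos θ * C 1 2 1 2 * hI
  obtain ⟨t1, t2, t3, t4⟩ := forall_angles (P := fun s c =>
      -4 * s ^ 2 * c * C 1 1 1 1 - 2 * s ^ 2 * c * C 1 1 2 2
        + c * (1 + c ^ 2) * (C 1 1 1 1 - C 1 1 2 2)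
        - 4 * C 1 2 1 2 * c + 8 * Complex.I * C 1 1 1 2 * c ^ 2
      = s ^ 2 * (Γ 1 * c + Γ 2 * Complex.I)) hτ
  have x1 : C 1 1 1 2 = 0 := by
    refine (mul_eq_zero.1 (?_ : Complex.I * C 1 1 1 2 = 0)).resolve_left Complex.I_ne_zero
    linear_combination (25 / 72) * ((t2 + t3) / 2 - (16 / 25) * t1)
  have x2 : C 1 1 2 2 = C 1 1 1 1 - 2 * C 1 2 1 2 := by
    linear_combination (1 / 14) * (15 * t2 - 20 * t4) - (6 / 35) * t1
      + (148 / 35) * Complex.I * x1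
  have q1 := hC.major 0 0 0 1
  have q2 := hC.major 0 0 0 2
  have q3 := hC.major 0 0 1 2
  have q4 := hC.major 0 0 2 2
  have q5 := hC.major 0 0 1 1
  exact ⟨q1.trans (z1 1 (by decide)).1, q2.trans (z1 2 (by decide)).1, q3.trans z3,
    q4.trans (z2.symm.trans q5.symm), shear.1, shear.2, y1.1, y3, y1.2, y2.1, y4, y2.2, x1,
    by rw [w5, x1, neg_zero], w1, x2⟩

lemma EquationsSeparate.separatesAt {J : Set ℝ} {c : ℝ → Tensor4} (h : EquationsSeparate J c)
    {r : ℝ} (hr : r ∈ J) {n : ℕ} {m : ℤ} (hm : m.natAbs ≤ n) (U V : Fin 3 → ℂ) :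
    SeparatesAt (c r) n m r U V := by
  set W : ℝ → Fin 3 → ℂ := fun s => U + (s - r) • V with hW
  have hWd : ∀ s, HasDerivAt W V s := fun s =>
    ((((hasDerivAt_id s).sub_const r).smul_const V).const_add U).congr_deriv (one_smul ℝ V)
  have hWr : W r = U := by simp [hW]
  obtain ⟨T, Γ, hT, hΓ⟩ := h n m hm W fun s _ => (hWd s).differentiableAt.differentiableWithinAt
  refine ⟨⟨T r, fun θ hθ => ?_⟩, Γ r, fun θ hθ j => ?_⟩
  · funext j
    have h1 := congrFun (hT r hr θ hθ 0) j
    rw [traction_expand hm c (hWd r) hθ, expand_apply, synth_eq, hWr] at h1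
    exact mul_left_cancel₀ (azim_ne_zero m 0) h1
  · have h1 := congrFun (hΓ r hr θ hθ 0) j
    rw [tau_expand hm c (hWd r) hθ, expand_apply, synth_eq, hWr] at h1
    have h2 := mul_left_cancel₀ (azim_ne_zero m 0) h1
    rw [← h2, mul_inv_cancel_left₀ (sin_ne_zero_of_mem hθ)]

/-- The derivative in `s` of a combination of `P, B, C` is a combination of `P, B, C`. -/
lemma exists_hasDerivAt_synth {n : ℕ} {m : ℤ} (hm : m.natAbs ≤ n) {W : ℝ → Fin 3 → ℂ} {r : ℝ}
    (h : ∀ θ ∈ Set.Ioo 0 Real.pi, ∀ φ j, DifferentiableAt ℝ (fun s => synth n m (W s) θ φ j) r) :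
    ∃ W', ∀ θ φ j, HasDerivAt (fun s => synth n m (W s) θ φ j) (synth n m W' θ φ j) r := by
  rcases eq_or_ne n 0 with rfl | hn
  · obtain rfl : m = 0 := by omega
    have hW : DifferentiableAt ℝ (fun s => (![W s 0, 0, 0] : Fin 3 → ℂ)) r := by
      refine differentiableAt_amplitudes hm (fun _ => .of_forall fun s => ⟨rfl, rfl⟩) ?_
      simpa only [← synth_degree_zero] using h
    refine ⟨deriv (fun s => (![W s 0, 0, 0] : Fin 3 → ℂ)) r, fun θ φ j => ?_⟩
    have := hasDerivAt_synth (n := 0) (m := 0) hW.hasDerivAt θ φ j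
    simpa only [← synth_degree_zero] using this
  · have hW := differentiableAt_amplitudes hm (fun h => absurd h hn) h
    exact ⟨_, fun θ φ j => hasDerivAt_synth hW.hasDerivAt θ φ j⟩

lemma synth_smul (n : ℕ) (m : ℤ) (x : ℂ) (a : Fin 3 → ℂ) (θ φ : ℝ) (j : Fin 3) :
    synth n m (x • a) θ φ j = x * synth n m a θ φ j := by
  simp [synth]
  ring

lemma synth_add (n : ℕ) (m : ℤ) (a b : Fin 3 → ℂ) (θ φ : ℝ) (j : Fin 3) :
    synth n m (a + b) θ φ j = synth n m a θ φ j + synth n m b θ φ j := by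
  simp [synth]
  ring

lemma AdmitsSeparableSolutions.separatesAt {J : Set ℝ} (hJpos : J ⊆ Set.Ioi 0) {c : ℝ → Tensor4}
    {ρ : ℝ → ℂ} {ω : ℂ} (h : AdmitsSeparableSolutions J c ρ ω)
    {r : ℝ} (hr : r ∈ J) {n : ℕ} {m : ℤ} (hm : m.natAbs ≤ n) (U₀ V₀ : Fin 3 → ℂ) :
    SeparatesAt (c r) n m r U₀ V₀ := by
  obtain ⟨N, hN, hrN, hNJ, U, T, hU₀, hV₀, hsol, hT⟩ := h n m hm r hr U₀ V₀
  have hrC : (r : ℂ) ≠ 0 := by exact_mod_cast (hJpos hr).ne'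
  have hW : ∀ θ ∈ Set.Ioo 0 Real.pi, ∀ φ j,
      (fun s : ℝ => (s : ℂ) ^ 2 * traction c (expand n m U) 0 s θ φ j)
        =ᶠ[nhds r] fun s => synth n m ((s : ℂ) ^ 2 • T s) θ φ j := by
    intro θ hθ φ j
    filter_upwards [hN.mem_nhds hrN] with s hs
    rw [hT s hs θ hθ φ, synth_smul, expand_apply]
  obtain ⟨W', hW'⟩ := exists_hasDerivAt_synth (W := fun s : ℝ => (s : ℂ) ^ 2 • T s) (r := r) hm
    fun θ hθ φ j => (hW θ hθ φ j).differentiableAt_iff.1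
      (hsol r hrN θ hθ φ j).2.2.2.2.2.differentiableAt
  refine ⟨⟨T r, fun θ hθ => ?_⟩, (-(r : ℂ)⁻¹) • (((r : ℂ) ^ 2 * ρ r * ω ^ 2) • U₀ + W'),
    fun θ hθ j => ?_⟩
  · funext j
    have h1 := congrFun (hT r hrN θ hθ 0) j
    rw [traction_expand hm c hV₀ hθ, expand_apply, synth_eq, hU₀] at h1
    exact mul_left_cancel₀ (azim_ne_zero m 0) h1
  · have h1 := ((hsol r hrN θ hθ 0 j).2.2.2.2.2.congr_of_eventuallyEq
      (hW θ hθ 0 j).symm).unique (hW' θ 0 j)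
    have h2 : tau c (expand n m U) r θ 0 j
        = synth n m ((-(r : ℂ)⁻¹) • (((r : ℂ) ^ 2 * ρ r * ω ^ 2) • U₀ + W')) θ 0 j := by
      rw [synth_smul, synth_add, synth_smul, ← h1, expand_apply, hU₀]
      field_simp
      ring
    rw [tau_expand hm c hV₀ hθ, synth_eq, hU₀] at h2
    rw [← mul_left_cancel₀ (azim_ne_zero m 0) h2, mul_inv_cancel_left₀ (sin_ne_zero_of_mem hθ)]

/-! ### The first-order system -/

/-- For a transversely isotropic material the radial traction and `τ` of `∑_A U_A A` are combinations
of `P, B, C` with the amplitudes `tractionAmp` and `tauAmp`. -/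
lemma TIRelations.traction_and_tau {c : ℝ → Tensor4} {r : ℝ} (H : TIRelations (c r))
    (hC : IsElastic (c r)) {n : ℕ} {m : ℤ} (hm : m.natAbs ≤ n) {U : ℝ → Fin 3 → ℂ}
    {V : Fin 3 → ℂ} (hU : HasDerivAt U V r) {θ : ℝ} (hθ : θ ∈ Set.Ioo 0 Real.pi) (φ : ℝ) :
    traction c (expand n m U) 0 r θ φ = synth n m (tractionAmp (c r) n r (U r) V) θ φ ∧
    tau c (expand n m U) r θ φ = synth n m (tauAmp (c r) n r (U r) V) θ φ := by
  constructor
  · funext j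
    rw [traction_expand hm c hU hθ, H.stress_radial hC, synth_eq]
  · funext j
    rw [tau_expand hm c hU hθ, H.tauForm_eq hC hm _ _ _ hθ, synth_eq,
      inv_mul_cancel_left₀ (sin_ne_zero_of_mem hθ)]

lemma equationsSeparate_of_tiRelations {J : Set ℝ} (hJ : IsOpen J) {c : ℝ → Tensor4}
    (hc : ∀ r ∈ J, IsElastic (c r)) (H : ∀ r ∈ J, TIRelations (c r)) : EquationsSeparate J c := by
  intro n m hm U hU
  have hd : ∀ r ∈ J, HasDerivAt U (deriv U r) r := fun r hr =>
    ((hU r hr).differentiableAt (hJ.mem_nhds hr)).hasDerivAt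
  exact ⟨fun r => tractionAmp (c r) n r (U r) (deriv U r),
    fun r => tauAmp (c r) n r (U r) (deriv U r),
    fun r hr θ hθ φ => ((H r hr).traction_and_tau (hc r hr) hm (hd r hr) hθ φ).1,
    fun r hr θ hθ φ => ((H r hr).traction_and_tau (hc r hr) hm (hd r hr) hθ φ).2⟩

lemma isUnit_det_matT {C : Tensor4} (h1 : c11 C ≠ 0) (h6 : c66 C ≠ 0) : IsUnit (matT C).det := by
  simp [matT, Matrix.det_diagonal, Fin.prod_univ_three, h1, h6]

/-- The right-hand side of the system in terms of the would-be derivative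
`V = 𝒯⁻¹ (T - r⁻¹ ℛᵀ U)` of `U`. -/
lemma stroh_rhs {c : ℝ → Tensor4} {ρ : ℝ → ℂ} {ω : ℂ} {n : ℕ} {r : ℝ} (hr : r ≠ 0)
    (U T : ℝ → Fin 3 → ℂ) {V : Fin 3 → ℂ}
    (hV : V = (matT (c r))⁻¹ *ᵥ (T r - (r : ℂ)⁻¹ • ((matR (c r) n)ᵀ *ᵥ U r))) :
    (Complex.I / (r : ℂ) ^ 2) • (matG c ρ ω n r *ᵥ stateVec U T r)
      = Sum.elim V (Complex.I • (-((r : ℂ) ^ 2 * ρ r * ω ^ 2) • U r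
        - (r : ℂ) • tauAmp (c r) n r (U r) V)) := by
  have hrC : (r : ℂ) ≠ 0 := by exact_mod_cast hr
  have hI := Complex.I_sq
  rw [matG, stateVec, Matrix.fromBlocks_mulVec]
  have hx : (matT (c r))⁻¹ *ᵥ T r
      = V + (r : ℂ)⁻¹ • ((matT (c r))⁻¹ *ᵥ ((matR (c r) n)ᵀ *ᵥ U r)) := by
    rw [hV, Matrix.mulVec_sub, Matrix.mulVec_smul]
    abel
  simp only [Sum.elim_comp_inl, Sum.elim_comp_inr, Matrix.smul_mulVec, Matrix.neg_mulVec,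
    Matrix.sub_mulVec, Matrix.mulVec_smul, ← Matrix.mulVec_mulVec, Matrix.one_mulVec, hx,
    Matrix.mulVec_add, tauAmp]
  generalize (matT (c r))⁻¹ *ᵥ ((matR (c r) n)ᵀ *ᵥ U r) = x
  ext (i | i)
  · simp
    field_simp
    linear_combination -(r * V i) * hI
  · simp
    field_simp
    linear_combination -(r * (matR (c r) n *ᵥ V) i + (matR (c r) n *ᵥ x) i) * hI

/-- The radial traction relation `T = 𝒯 V + r⁻¹ ℛᵀ U`, solved for `V`. -/
lemma eq_tractionAmp_iff {C : Tensor4} (hu : IsUnit (matT C).det) (n : ℕ) (r : ℝ)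
    (U V T : Fin 3 → ℂ) :
    T = tractionAmp C n r U V ↔ V = (matT C)⁻¹ *ᵥ (T - (r : ℂ)⁻¹ • ((matR C n)ᵀ *ᵥ U)) := by
  constructor
  · rintro rfl
    rw [tractionAmp, add_sub_cancel_right, Matrix.mulVec_mulVec, Matrix.nonsing_inv_mul _ hu,
      Matrix.one_mulVec]
  · rintro rfl
    rw [tractionAmp, Matrix.mulVec_mulVec, Matrix.mul_nonsing_inv _ hu, Matrix.one_mulVec,
      sub_add_cancel]

lemma hasDerivAt_stateVec_iff {U T : ℝ → Fin 3 → ℂ} {r : ℝ} {V W' : Fin 3 → ℂ} :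
    HasDerivAt (stateVec U T) (Sum.elim V (Complex.I • W')) r ↔
      HasDerivAt U V r ∧ HasDerivAt (fun s : ℝ => (s : ℂ) ^ 2 • T s) W' r := by
  have hI := Complex.I_mul_I
  constructor
  · intro h
    have h := hasDerivAt_pi.1 h
    refine ⟨hasDerivAt_pi.2 fun i => h (Sum.inl i), hasDerivAt_pi.2 fun i => ?_⟩
    refine (((h (Sum.inr i)).const_mul (-Complex.I)).congr_of_eventuallyEq
      (.of_forall fun s => ?_)).congr_deriv ?_
    · simp [stateVec]
      linear_combination (s ^ 2 * T s i) * hI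
    · simp
      linear_combination (-W' i) * hI
  · rintro ⟨hU, hW⟩
    have hU := hasDerivAt_pi.1 hU
    have hW := hasDerivAt_pi.1 hW
    refine hasDerivAt_pi.2 ?_
    rintro (i | i)
    · exact hU i
    · refine ((hW i).const_mul Complex.I).congr_of_eventuallyEq (.of_forall fun s => ?_)
      simp [stateVec]
      ring

lemma amp_degree_zero (C : Tensor4) (r : ℝ) {U V : Fin 3 → ℂ} (hU : U 1 = 0 ∧ U 2 = 0)
    (hV : V 1 = 0 ∧ V 2 = 0) :
    (tractionAmp C 0 r U V 1 = 0 ∧ tractionAmp C 0 r U V 2 = 0) ∧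
      tauAmp C 0 r U V 1 = 0 ∧ tauAmp C 0 r U V 2 = 0 := by
  rw [tractionAmp_eq, tauAmp_eq]
  simp [lam_zero, hU, hV]

lemma deriv_components_eq_zero {W : ℝ → Fin 3 → ℂ} {W' : Fin 3 → ℂ} {r : ℝ}
    (h : ∀ᶠ s in nhds r, W s 1 = 0 ∧ W s 2 = 0) (hW : HasDerivAt W W' r) : W' 1 = 0 ∧ W' 2 = 0 := by
  have hW := hasDerivAt_pi.1 hW
  exact ⟨(hW 1).unique ((hasDerivAt_const r (0 : ℂ)).congr_of_eventuallyEq (h.mono fun s hs => hs.1)),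
    (hW 2).unique ((hasDerivAt_const r (0 : ℂ)).congr_of_eventuallyEq (h.mono fun s hs => hs.2))⟩

lemma isSeparableSolution_iff {J : Set ℝ} (hJ : IsOpen J) (hJpos : J ⊆ Set.Ioi 0) {c : ℝ → Tensor4}
    (hc : ∀ r ∈ J, IsElastic (c r)) (H : ∀ r ∈ J, TIRelations (c r)) {ρ : ℝ → ℂ} {ω : ℂ}
    (hcc : ∀ r ∈ J, c11 (c r) ≠ 0 ∧ c66 (c r) ≠ 0) {n : ℕ} {m : ℤ} (hm : m.natAbs ≤ n)
    {U T : ℝ → Fin 3 → ℂ} (h0 : n = 0 → ∀ r ∈ J, U r 1 = 0 ∧ U r 2 = 0 ∧ T r 1 = 0 ∧ T r 2 = 0) :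
    IsSeparableSolution J c ρ ω n m U T ↔ SolvesStroh J c ρ ω n U T := by
  have hr0 : ∀ r ∈ J, r ≠ 0 := fun r hr => (hJpos hr).ne'
  have hu : ∀ r ∈ J, IsUnit (matT (c r)).det := fun r hr =>
    isUnit_det_matT (hcc r hr).1 (hcc r hr).2
  constructor
  · rintro ⟨hsol, hT⟩ r hr
    have hJr := hJ.mem_nhds hr
    have hU0 : n = 0 → ∀ᶠ s in nhds r, U s 1 = 0 ∧ U s 2 = 0 := fun hn => by
      filter_upwards [hJr] with s hs using ⟨(h0 hn s hs).1, (h0 hn s hs).2.1⟩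
    have hW0 : n = 0 → ∀ᶠ s : ℝ in nhds r,
        ((s : ℂ) ^ 2 • T s) 1 = 0 ∧ ((s : ℂ) ^ 2 • T s) 2 = 0 := fun hn => by
      filter_upwards [hJr] with s hs
      simp [(h0 hn s hs).2.2.1, (h0 hn s hs).2.2.2]
    have hU := (differentiableAt_amplitudes hm hU0
      fun θ hθ φ j => (hsol r hr θ hθ φ j).1).hasDerivAt
    set V := deriv U r
    have htt := fun θ hθ φ => (H r hr).traction_and_tau (hc r hr) hm hU (θ := θ) hθ φ
    have hV0 : n = 0 → V 1 = 0 ∧ V 2 = 0 := fun hn => deriv_components_eq_zero (hU0 hn) hU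
    have hTr : T r = tractionAmp (c r) n r (U r) V := by
      refine eq_of_synth_eq hm ?_ fun θ hθ φ j => ?_
      · rintro rfl
        have h0 := h0 rfl r hr
        exact ⟨h0.2.2, (amp_degree_zero _ _ ⟨h0.1, h0.2.1⟩ (hV0 rfl)).1⟩
      · rw [← (htt θ hθ φ).1, hT r hr θ hθ φ, expand_apply]
    have hWe : ∀ θ ∈ Set.Ioo 0 Real.pi, ∀ φ j,
        (fun s => synth n m ((s : ℂ) ^ 2 • T s) θ φ j) =ᶠ[nhds r]
          fun s : ℝ => (s : ℂ) ^ 2 * traction c (expand n m U) 0 s θ φ j := by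
      intro θ hθ φ j
      filter_upwards [hJr] with s hs
      rw [hT s hs θ hθ φ, synth_smul, expand_apply]
    have hWd := fun θ hθ φ j =>
      (hsol r hr θ hθ φ j).2.2.2.2.2.congr_of_eventuallyEq (hWe θ hθ φ j)
    have hW := (differentiableAt_amplitudes (W := fun s : ℝ => (s : ℂ) ^ 2 • T s) hm hW0
      fun θ hθ φ j => (hWd θ hθ φ j).differentiableAt).hasDerivAt
    have hW' : deriv (fun s : ℝ => (s : ℂ) ^ 2 • T s) r
        = -((r : ℂ) ^ 2 * ρ r * ω ^ 2) • U r - (r : ℂ) • tauAmp (c r) n r (U r) V := by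
      refine eq_of_synth_eq hm ?_ fun θ hθ φ j => ?_
      · rintro rfl
        have h0 := h0 rfl r hr
        have h1 := (amp_degree_zero (c r) r ⟨h0.1, h0.2.1⟩ (hV0 rfl)).2
        exact ⟨deriv_components_eq_zero (hW0 rfl) hW, by simp [h0, h1]⟩
      · rw [← (hasDerivAt_synth hW θ φ j).unique (hWd θ hθ φ j) |>.symm, (htt θ hθ φ).2,
          expand_apply, sub_eq_add_neg _ ((r : ℂ) • _), ← neg_smul, synth_add, synth_smul,
          synth_smul]
        ring
    rw [stroh_rhs (hr0 r hr) U T ((eq_tractionAmp_iff (hu r hr) n r _ _ _).1 hTr), ← hW',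
      hasDerivAt_stateVec_iff]
    exact ⟨hU, hW⟩
  · intro h
    set V : ℝ → Fin 3 → ℂ :=
      fun r => (matT (c r))⁻¹ *ᵥ (T r - (r : ℂ)⁻¹ • ((matR (c r) n)ᵀ *ᵥ U r)) with hV
    have hd : ∀ r ∈ J, HasDerivAt U (V r) r ∧ HasDerivAt (fun s : ℝ => (s : ℂ) ^ 2 • T s)
        (-((r : ℂ) ^ 2 * ρ r * ω ^ 2) • U r - (r : ℂ) • tauAmp (c r) n r (U r) (V r)) r := by
      intro r hr
      have h1 := h r hr
      rwa [stroh_rhs (hr0 r hr) U T (V := V r) rfl, hasDerivAt_stateVec_iff] at h1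
    have hTr : ∀ r ∈ J, T r = tractionAmp (c r) n r (U r) (V r) := fun r hr =>
      (eq_tractionAmp_iff (hu r hr) n r _ _ _).2 rfl
    have htt := fun r hr θ hθ φ =>
      (H r hr).traction_and_tau (hc r hr) hm (hd r hr).1 (θ := θ) hθ φ
    have hT : HasAmplitudes J n m (traction c (expand n m U) 0) T := fun r hr θ hθ φ => by
      rw [(htt r hr θ hθ φ).1, expand_apply, hTr r hr]
    refine ⟨fun r hr θ hθ φ j => ⟨(hasDerivAt_synth (hd r hr).1 θ φ j).differentiableAt,
      (hasDerivAt_synth_theta hm (U r) hθ φ j).differentiableAt,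
      (hasDerivAt_synth_phi n m (U r) θ φ j).differentiableAt,
      (hasDerivAt_sin_mul_traction hm c (hd r hr).1 hθ φ j).differentiableAt,
      (hasDerivAt_traction_phi hm c (hd r hr).1 hθ φ j).differentiableAt, ?_⟩, hT⟩
    refine ((hasDerivAt_synth (n := n) (m := m) (hd r hr).2 θ φ j).congr_of_eventuallyEq ?_).congr_deriv ?_
    · filter_upwards [hJ.mem_nhds hr] with s hs
      rw [hT s hs θ hθ φ, synth_smul, expand_apply]
    · rw [(htt r hr θ hθ φ).2, expand_apply, sub_eq_add_neg, ← neg_smul, synth_add, synth_smul,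
        synth_smul]
      ring

/-! ### Symmetry of the system matrix -/

lemma matG_symmetry {c : ℝ → Tensor4} {ρ : ℝ → ℂ} {ω : ℂ} {r : ℝ}
    (hc : ∀ i j k l, (c r i j k l).im = 0) (hρ : (ρ r).im = 0) (hω : (ω ^ 2).im = 0) (n : ℕ) :
    matG c ρ ω n r = swapT * (matG c ρ ω n r)ᴴ * swapT := by
  have hs : ∀ i j k l, star (c r i j k l) = c r i j k l := fun i j k l =>
    Complex.conj_eq_iff_im.2 (hc i j k l)
  have hρ' : star (ρ r) = ρ r := Complex.conj_eq_iff_im.2 hρ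
  have hω' : star (ω ^ 2) = ω ^ 2 := Complex.conj_eq_iff_im.2 hω
  have hre : ∀ x : ℝ, star (x : ℂ) = x := Complex.conj_ofReal
  have hI : star Complex.I = -Complex.I := Complex.conj_I
  have hT : (matT (c r))ᴴ = matT (c r) := by
    rw [matT, Matrix.diagonal_conjTranspose]
    congr 1
    ext i
    fin_cases i <;> simp [c11, c66, hs]
  have hR : (matR (c r) n)ᴴ = (matR (c r) n)ᵀ := by
    ext i j
    fin_cases i <;> fin_cases j <;> simp [matR, c12, c66, hs, hre]
  have hRt : (matR (c r) n)ᵀᴴ = matR (c r) n := by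
    ext i j
    fin_cases i <;> fin_cases j <;> simp [matR, c12, c66, hs, hre]
  have hQ : (matQ (c r) n)ᴴ = matQ (c r) n := by
    ext i j
    fin_cases i <;> fin_cases j <;> simp [matQ, c22, c44, c66, hs, hre]
  have hTi : ((matT (c r))⁻¹)ᴴ = (matT (c r))⁻¹ := by
    rw [Matrix.conjTranspose_nonsing_inv, hT]
  rw [matG, swapT, Matrix.fromBlocks_conjTranspose, Matrix.fromBlocks_multiply,
    Matrix.fromBlocks_multiply]
  simp only [zero_mul, one_mul, mul_zero, mul_one, zero_add, add_zero,
    Matrix.conjTranspose_smul, Matrix.conjTranspose_mul, Matrix.conjTranspose_sub,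
    Matrix.conjTranspose_neg, Matrix.conjTranspose_one, hTi, hR, hRt, hQ, star_neg, star_mul,
    star_pow, hre, hI, hρ', hω']
  congr 1
  · module
  · rw [mul_assoc (matR (c r) n)]
    congr 2
    ring
  · congr 1
    ring

end SphericalStroh

end

open SphericalStroh in
/-- `J` is the set of radii of the body. For `n = 0` the harmonics `B`, `C` vanish, and their
amplitudes are taken to be zero in the first-order system. -/
theorem theorem1 (J : Set ℝ) (hJ : IsOpen J) (hJpos : J ⊆ Set.Ioi 0)
    (c : ℝ → Tensor4) (hc : ∀ r ∈ J, IsElastic (c r)) (ρ : ℝ → ℂ) (ω : ℂ) :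
    (EquationsSeparate J c ↔ ∀ r ∈ J, IsTI (c r)) ∧
    (AdmitsSeparableSolutions J c ρ ω → ∀ r ∈ J, IsTI (c r)) ∧
    ((∀ r ∈ J, IsTI (c r)) → (∀ r ∈ J, c11 (c r) ≠ 0 ∧ c66 (c r) ≠ 0) →
      (∀ (n : ℕ) (m : ℤ), m.natAbs ≤ n → ∀ U T : ℝ → Fin 3 → ℂ,
        (n = 0 → ∀ r ∈ J, U r 1 = 0 ∧ U r 2 = 0 ∧ T r 1 = 0 ∧ T r 2 = 0) →
          (IsSeparableSolution J c ρ ω n m U T ↔ SolvesStroh J c ρ ω n U T)) ∧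
      ((∀ r ∈ J, ∀ i j k l, (c r i j k l).im = 0) → (∀ r ∈ J, (ρ r).im = 0) →
        (ω ^ 2).im = 0 →
          ∀ n : ℕ, ∀ r ∈ J, matG c ρ ω n r = swapT * (matG c ρ ω n r)ᴴ * swapT)) := by
  have hr0 : ∀ r ∈ J, r ≠ 0 := fun r hr => (hJpos hr).ne'
  have hTI : ∀ r ∈ J, IsTI (c r) → TIRelations (c r) := fun r hr H => H.tiRelations (hc r hr)
  refine ⟨⟨fun h r hr => ?_, fun h => ?_⟩, fun h r hr => ?_, fun h hcc => ⟨?_, ?_⟩⟩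
  · exact (TIRelations.of_separatesAt (hc r hr) (hr0 r hr)
      fun n m hm U V => h.separatesAt hr hm U V).isTI (hc r hr)
  · exact equationsSeparate_of_tiRelations hJ hc fun r hr => hTI r hr (h r hr)
  · exact (TIRelations.of_separatesAt (hc r hr) (hr0 r hr)
      fun n m hm U V => h.separatesAt hJpos hr hm U V).isTI (hc r hr)
  · intro n m hm U T h0
    exact isSeparableSolution_iff hJ hJpos hc (fun r hr => hTI r hr (h r hr)) hcc hm h0
  · intro hcr hρ hω n r hr
    exact matG_symmetry (hcr r hr) (hρ r hr) hω n
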